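/- An $N_K=1$ SUSY vertex algebra is a complex superspace $V$ with an even vacuum $|0\rangle$, an odd endomorphism $D$, and a parity preserving assignment of superfields $Y(a,z,\theta)=\sum_{j\in\mathbb Z}z^{-j-1}a_{(j|1)}+\theta\sum_{j\in\mathbb Z}z^{-j-1}a_{(j|0)}$ to the vectors $a\in V$, satisfying the vacuum axiom ($D|0\rangle=0$, $Y(a,z,\theta)|0\rangle|_{z=\theta=0}=a$), translation covariance $[D,Y(a,z,\theta)]=(\partial_\theta-\theta\partial_z)Y(a,z,\theta)$, and locality. Put $\partial=D^2$, ${:}ab{:}=a_{(-1|1)}b$, and $$[a_\Lambda b]=\sum_{j\ge0}\frac{\lambda^j}{j!}a_{(j|0)}b+\chi\sum_{j\ge0}\frac{\lambda^j}{j!}a_{(j|1)}b\in\mathbb C[\lambda,\chi]\otimes V,$$ where $\lambda$ is even, $\chi$ is odd, $\chi^2=-\lambda$ and $\lambda\chi=\chi\lambda$. An odd vector $T$ is an $N=1$ superconformal vector of central charge $c\in\mathbb C$ if $$[T_\Lambda T]=(2\partial+3\lambda+\chi D)T+\tfrac c3\lambda^2\chi|0\rangle,\qquad T_{(0|0)}=2\partial,\qquad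 T_{(0|1)}=D,$$ and $T_{(1|0)}$ is diagonalizable on $V$. Such a $T$ and an even vector $J$ generate an $N=2$ superconformal structure of central charge $c$ if moreover $$[T_\Lambda J]=(2\partial+2\lambda+\chi D)J,\qquad [J_\Lambda J]=T+\tfrac c3\lambda\chi|0\rangle .$$ Let $U$ be a finite-dimensional complex superspace with a homogeneous basis $A=A_{\bar0}\sqcup A_{\bar1}$ (even and odd part). The SUSY charged free fermion vertex algebra $F^{ch}_{N=1}$ is the universal enveloping $N_K=1$ SUSY vertex algebra of the SUSY Lie conformal algebra freely generated over $\mathbb C[\partial,D]$, $D^2=\partial$, by vectors $\phi_a$, $\phi^{\bar a}$ ($a\in A$), where $\phi_a$ has the parity of $a$ and $\phi^{\bar a}$ the opposite one, with $$[{\phi_a}_\Lambda\phi^{\bar b}]=\delta_{ab},\qquad [{\phi_a}_\Lambda\phi_b]=[{\phi^{\bar a}}_\Lambda\phi^{\bar b}]=0 .$$ As a superspace it is the free supercommutative algebra on the $D^n\phi_a$, $D^n\phi^{\bar a}$ ($n\ge0$), with unit $|0\rangle$. **Theorem.** Let $(t_a)_{a\in A}$ be arbitrary complex numbers. Define the following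 vectors of $F^{ch}_{N=1}$, where all products are normally ordered: $$T^{ch}_{sh}=\sum_{a\in A_{\bar0}}\big((t_a+1)\,\partial\phi_a\phi^{\bar a}+t_a\,\phi_a\partial\phi^{\bar a}+D\phi_aD\phi^{\bar a}\big)+\sum_{a\in A_{\bar1}}\big(t_a\,\partial\phi_a\phi^{\bar a}+(t_a+1)\,\phi_a\partial\phi^{\bar a}+D\phi_aD\phi^{\bar a}\big),$$ $$J^{ch}_{st}=\sum_{a\in A_{\bar0}}D\phi_a\phi^{\bar a}+\sum_{a\in A_{\bar1}}D\phi^{\bar a}\phi_a,$$ $$J^{ch}_{ghost}=\sum_{a\in A_{\bar0}}t_a\big(D\phi_a\phi^{\bar a}+\phi_aD\phi^{\bar a}\big)+\sum_{a\in A_{\bar1}}t_a\big(D\phi^{\bar a}\phi_a+\phi^{\bar a}D\phi_a\big),$$ and set $J^{ch}_{sh}=J^{ch}_{st}+J^{ch}_{ghost}$ and $c_{sh}=\sum_{a\in A}(6t_a+3)$. Then $T^{ch}_{sh}$ and $J^{ch}_{sh}$ generate an $N=2$ superconformal structure of central charge $c_{sh}$. That is, $T=T^{ch}_{sh}$ is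 an $N=1$ superconformal vector of central charge $c_{sh}$, the vector $J=J^{ch}_{sh}$ is even, and $$[T_\Lambda J]=(2\partial+2\lambda+\chi D)J,\qquad [J_\Lambda J]=T+\tfrac{c_{sh}}3\lambda\chi|0\rangle .$$ -/

import Mathlib

/-! # The SUSY charged free fermion vertex algebra and its shifted `N = 2` currents

First come the general notions: `N_K = 1` SUSY vertex algebras, the `Λ`-bracket, and `N = 1` and
`N = 2` superconformal structures.  Then the SUSY charged free fermion vertex algebra `fch` is
constructed, with all its axioms proved.  The superconformal vector and the currents are defined at
the end. -/

namespace SusyVA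

/-- The Koszul sign `(-1)^{pq}`. -/
def ksign (p q : ZMod 2) : ℂ := (-1) ^ (p.val * q.val)

theorem ksign_comm (p q : ZMod 2) : ksign p q = ksign q p := by
  simp [ksign, mul_comm]

theorem ksign_add_left (p q r : ZMod 2) : ksign (p + q) r = ksign p r * ksign q r := by
  revert p q r
  have key : ∀ p q r : Fin 2, ksign (show ZMod 2 from p + q) r = ksign p r * ksign q r := by
    intro p q r
    fin_cases p <;> fin_cases q <;> fin_cases r <;> simp [ksign, ZMod.val]
  exact key

theorem ksign_add_right (p q r : ZMod 2) : ksign p (q + r) = ksign p q * ksign p r := by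
  rw [ksign_comm, ksign_add_left, ksign_comm q, ksign_comm r]

@[simp] theorem ksign_mul_self (p q : ZMod 2) : ksign p q * ksign p q = 1 := by
  simp [ksign, ← pow_add, ← two_mul]

@[simp] theorem ksign_mul_self_assoc (p q : ZMod 2) (c : ℂ) :
    ksign p q * (ksign p q * c) = c := by
  rw [← mul_assoc, ksign_mul_self, one_mul]

@[simp] theorem ksign_zero_left (p : ZMod 2) : ksign 0 p = 1 := by simp [ksign]

@[simp] theorem ksign_zero_right (p : ZMod 2) : ksign p 0 = 1 := by simp [ksign]

@[simp] theorem ksign_one_one : ksign 1 1 = -1 := by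
  simp [ksign, ZMod.val_one]

/-- An `N_K = 1` SUSY vertex algebra over `ℂ`: a superspace `V = grade 0 ⊕ grade 1`, an even vacuum
vector, an odd endomorphism `D`, and a state-field correspondence, given by the Fourier modes
`mode j ε a = a_(j|ε)` of the superfields
`Y(a, z, θ) = ∑ z^{-j-1} a_(j|1) + θ ∑ z^{-j-1} a_(j|0)`. -/
structure NK1SUSYVertexAlgebra (V : Type*) [AddCommGroup V] [Module ℂ V] where
  /-- the even part `grade 0` and the odd part `grade 1` -/
  grade : ZMod 2 → Submodule ℂ V
  isCompl : IsCompl (grade 0) (grade 1)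
  /-- the vacuum vector -/
  vac : V
  vac_mem : vac ∈ grade 0
  /-- the odd endomorphism -/
  D : V →ₗ[ℂ] V
  D_mem : ∀ {p : ZMod 2} {a : V}, a ∈ grade p → D a ∈ grade (p + 1)
  /-- `mode j ε a b = a_(j|ε) b` -/
  mode : ℤ → ZMod 2 → V →ₗ[ℂ] V →ₗ[ℂ] V
  /-- `Y(a, z, θ)` is a superfield -/
  mode_finite : ∀ (ε : ZMod 2) (a b : V), ∃ N : ℤ, ∀ j : ℤ, N ≤ j → mode j ε a b = 0
  /-- `Y` preserves parity (`θ` is odd, so that `a_(j|1)` has the parity of `a` and `a_(j|0)` the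
  opposite one) -/
  mode_mem : ∀ (j : ℤ) (ε : ZMod 2) {p q : ZMod 2} {a b : V}, a ∈ grade p → b ∈ grade q →
    mode j ε a b ∈ grade (p + q + ε + 1)
  D_vac : D vac = 0
  /-- `Y(a, z, θ)|0⟩` has no negative powers of `z` -/
  mode_vac : ∀ (j : ℤ) (ε : ZMod 2) (a : V), 0 ≤ j → mode j ε a vac = 0
  /-- `Y(a, z, θ)|0⟩` takes the value `a` at `z = 0`, `θ = 0` -/
  mode_neg_one_vac : ∀ a : V, mode (-1) 1 a vac = a
  /-- translation covariance `[D, Y(a, z, θ)] = (∂_θ - θ ∂_z) Y(a, z, θ)`, constant term in `θ` -/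
  translation_one : ∀ (j : ℤ) {p : ZMod 2} {a : V}, a ∈ grade p → ∀ b : V,
    D (mode j 1 a b) - ksign 1 p • mode j 1 a (D b) = mode j 0 a b
  /-- translation covariance, coefficient of `θ` (where `D θ = - θ D`) -/
  translation_zero : ∀ (j : ℤ) {p : ZMod 2} {a : V}, a ∈ grade p → ∀ b : V,
    D (mode j 0 a b) - ksign 1 (p + 1) • mode j 0 a (D b) = -(j : ℂ) • mode (j - 1) 1 a b
  /-- locality `(z - w)^N [Y(a, z, θ), Y(b, w, ζ)] = 0`, by coefficients; the component `a_(j|ε)`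
  of the field of a vector of parity `p` has parity `p + ε + 1` -/
  locality : ∀ {p q : ZMod 2} {a b : V}, a ∈ grade p → b ∈ grade q → ∃ N : ℕ,
    ∀ (ε ε' : ZMod 2) (m n : ℤ) (v : V),
      ∑ i ∈ Finset.range (N + 1), ((-1 : ℂ) ^ i * N.choose i) •
        (mode (m + N - i) ε a (mode (n + i) ε' b v) -
          ksign (p + ε + 1) (q + ε' + 1) • mode (n + i) ε' b (mode (m + N - i) ε a v)) = 0

/-- `ℂ[λ, χ] ⊗ V` for the algebra generated by an even `λ` and an odd `χ` with `χ² = -λ` and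
`λχ = χλ`. A basis of this algebra is `λ^j χ^ε` with `j ≥ 0` and `ε = 0, 1`; an element is given by
its coefficients in `V`. -/
abbrev LambdaPoly (V : Type*) [AddCommGroup V] := (ℕ × ZMod 2) →₀ V

/-- The element `λ^j χ^ε v` of `ℂ[λ, χ] ⊗ V`. -/
noncomputable def lamChi {V : Type*} [AddCommGroup V] (j : ℕ) (ε : ZMod 2) (v : V) : LambdaPoly V :=
  Finsupp.single (j, ε) v

namespace NK1SUSYVertexAlgebra

variable {V : Type*} [AddCommGroup V] [Module ℂ V] (S : NK1SUSYVertexAlgebra V)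

/-- the even translation operator `∂ = D²` -/
def del : V →ₗ[ℂ] V := S.D ∘ₗ S.D

/-- the normally ordered product `:ab: = a_(-1|1) b` -/
def nop (a b : V) : V := S.mode (-1) 1 a b

theorem bracket_finite (a b : V) : (Function.support fun x : ℕ × ZMod 2 =>
    ((x.1.factorial : ℂ)⁻¹) • S.mode (x.1 : ℤ) x.2 a b).Finite := by
  choose N hN using fun ε => S.mode_finite ε a b
  refine ((Set.finite_iUnion fun ε : ZMod 2 =>
    ((Set.finite_Iio (N ε).toNat).prod (Set.finite_singleton ε)))).subset fun x hx => ?_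
  simp only [Set.mem_iUnion]
  refine ⟨x.2, ?_, rfl⟩
  by_contra h
  refine hx ?_
  have : N x.2 ≤ (x.1 : ℤ) := by
    have h' : ¬ x.1 < (N x.2).toNat := h
    omega
  simp only [hN x.2 x.1 this, smul_zero]

/-- The `Λ`-bracket `[a _Λ b] = ∑_{j ≥ 0} λ^j/j! a_(j|0) b + χ ∑_{j ≥ 0} λ^j/j! a_(j|1) b`. -/
noncomputable def bracket (a b : V) : LambdaPoly V :=
  Finsupp.ofSupportFinite (fun x : ℕ × ZMod 2 =>
    ((x.1.factorial : ℂ)⁻¹) • S.mode (x.1 : ℤ) x.2 a b) (S.bracket_finite a b)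

/-- `v` is an `N = 1` superconformal vector of central charge `c`: it is odd,
`[v _Λ v] = (2∂ + 3λ + χD)v + (c/3) λ²χ`, `v_(0|0) = 2∂`, `v_(0|1) = D`, and `v_(1|0)` is
diagonalizable. -/
structure IsSuperconformalVector (v : V) (c : ℂ) : Prop where
  odd : v ∈ S.grade 1
  bracket_self : S.bracket v v = lamChi 0 0 ((2 : ℂ) • S.del v) + lamChi 1 0 ((3 : ℂ) • v) +
    lamChi 0 1 (S.D v) + lamChi 2 1 ((c / 3) • S.vac)
  mode_zero_zero : S.mode 0 0 v = (2 : ℂ) • S.del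
  mode_zero_one : S.mode 0 1 v = S.D
  diagonalizable : ⨆ μ : ℂ, Module.End.eigenspace (S.mode 1 0 v) μ = ⊤

/-- `v` and `J` generate an `N = 2` superconformal structure of central charge `c`: `v` is an
`N = 1` superconformal vector of central charge `c`, `J` is even,
`[v _Λ J] = (2∂ + 2λ + χD)J` and `[J _Λ J] = v + (c/3) λχ`. -/
structure IsN2Superconformal (v J : V) (c : ℂ) : Prop where
  superconformal : S.IsSuperconformalVector v c
  even : J ∈ S.grade 0
  bracket_current : S.bracket v J = lamChi 0 0 ((2 : ℂ) • S.del J) + lamChi 1 0 ((2 : ℂ) • J) +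
    lamChi 0 1 (S.D J)
  bracket_current_current : S.bracket J J = lamChi 0 0 v + lamChi 1 1 ((c / 3) • S.vac)

end NK1SUSYVertexAlgebra

/-! ## The underlying superspace

Let `A` be a homogeneous basis of the superspace `U`, the parity of `a` being `par a`.  The
supersymmetric Lie conformal algebra `R` of `U` has the basis `D^n φ_a`, `D^n φ^{ā}`
(`n ≥ 0`, `a ∈ A`), and all `Λ`-brackets of these elements are scalar multiples of the vacuum.  Its
universal enveloping SUSY vertex algebra is the tensor algebra of `R` modulo
`ab - (-1)^{ab} ba = ∫_{-∇}^0 [a _Λ b] dΛ`.  The right-hand side vanishes here, as it is obtained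
by applying a positive power of `∂` or `D` to a multiple of the vacuum, so that the underlying
superspace is the free supercommutative algebra on these generators. -/

/-- The generators: `⟨false, a, n⟩` stands for `D^n φ_a` and `⟨true, a, n⟩` for `D^n φ^{ā}`. -/
@[ext] structure Gen (A : Type*) where
  up : Bool
  idx : A
  ord : ℕ

section Fock

variable {A : Type*} (par : A → ZMod 2)

/-- The parity of `φ_a` is that of `a`, and the parity of `φ^{ā}` is the opposite one. -/
def gpar (up : Bool) (a : A) : ZMod 2 := if up then par a + 1 else par a

/-- The parity of a generator. -/
def Gen.parity (x : Gen A) : ZMod 2 := gpar par x.up x.idx + x.ord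

/-- `D` applied to a generator. -/
def Gen.succ (x : Gen A) : Gen A := ⟨x.up, x.idx, x.ord + 1⟩

/-- The relations `xy = (-1)^{xy} yx`. -/
inductive SuperComm : FreeAlgebra ℂ (Gen A) → FreeAlgebra ℂ (Gen A) → Prop
  | swap (x y : Gen A) :
      SuperComm (FreeAlgebra.ι ℂ x * FreeAlgebra.ι ℂ y)
        (ksign (x.parity par) (y.parity par) • (FreeAlgebra.ι ℂ y * FreeAlgebra.ι ℂ x))

/-- The free supercommutative `ℂ`-algebra on the generators, which underlies the SUSY charged free
fermion vertex algebra.  Its unit is the vacuum. -/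
def Fock : Type _ := RingQuot (SuperComm par)

noncomputable instance : Ring (Fock par) := inferInstanceAs (Ring (RingQuot (SuperComm par)))

noncomputable instance : Algebra ℂ (Fock par) :=
  inferInstanceAs (Algebra ℂ (RingQuot (SuperComm par)))

/-- The projection from the free algebra. -/
noncomputable def mk : FreeAlgebra ℂ (Gen A) →ₐ[ℂ] Fock par := RingQuot.mkAlgHom ℂ (SuperComm par)

theorem mk_surjective : Function.Surjective (mk par) :=
  RingQuot.mkAlgHom_surjective ℂ (SuperComm par)

/-- A generator as a vector. -/
noncomputable def gen (x : Gen A) : Fock par :=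
  mk par (FreeAlgebra.ι ℂ x)

theorem gen_swap (x y : Gen A) :
    gen par x * gen par y = ksign (x.parity par) (y.parity par) • (gen par y * gen par x) := by
  have : mk par _ = mk par _ := RingQuot.mkAlgHom_rel ℂ (SuperComm.swap (par := par) x y)
  simpa [gen] using this

/-- The universal property of the free supercommutative algebra. -/
noncomputable def lift {B : Type*} [Ring B] [Algebra ℂ B] (f : Gen A → B)
    (hf : ∀ x y, f x * f y = ksign (x.parity par) (y.parity par) • (f y * f x)) : Fock par →ₐ[ℂ] B :=
  RingQuot.liftAlgHom ℂ (s := SuperComm par) ⟨FreeAlgebra.lift ℂ f, by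
    rintro _ _ ⟨x, y⟩
    simpa using hf x y⟩

@[simp] theorem lift_gen {B : Type*} [Ring B] [Algebra ℂ B] (f : Gen A → B)
    (hf : ∀ x y, f x * f y = ksign (x.parity par) (y.parity par) • (f y * f x)) (x : Gen A) :
    lift par f hf (gen par x) = f x := by
  exact (RingQuot.liftAlgHom_mkAlgHom_apply ℂ _ _ _).trans (FreeAlgebra.lift_ι_apply _ _)

theorem Fock.ind {P : Fock par → Prop} (one : P 1) (add : ∀ u v, P u → P v → P (u + v))
    (smul : ∀ (c : ℂ) u, P u → P (c • u)) (mul : ∀ x v, P v → P (gen par x * v)) (v : Fock par) :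
    P v := by
  obtain ⟨w, rfl⟩ := mk_surjective par v
  suffices h : ∀ v, P v → P (mk par w * v) by
    simpa using h 1 one
  induction w using FreeAlgebra.induction with
  | grade0 r =>
    intro v hv
    have := smul r v hv
    rwa [Algebra.smul_def, ← AlgHom.commutes (mk par)] at this
  | grade1 x => exact fun v hv => mul x v hv
  | mul a b ha hb => intro v hv; rw [map_mul, mul_assoc]; exact ha _ (hb _ hv)
  | add a b ha hb => intro v hv; rw [map_add, add_mul]; exact add _ _ (ha _ hv) (hb _ hv)

/-- The automorphism acting by `(-1)^{qp}` on vectors of parity `p`. -/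
noncomputable def tw (q : ZMod 2) : Fock par →ₐ[ℂ] Fock par :=
  lift par (fun x => ksign q (x.parity par) • gen par x) (by
    intro x y
    simp only [smul_mul_smul_comm, gen_swap par x y, smul_smul]
    ring_nf)

@[simp] theorem tw_gen (q : ZMod 2) (x : Gen A) :
    tw par q (gen par x) = ksign q (x.parity par) • gen par x := lift_gen _ _ _ _

theorem tw_tw (q r : ZMod 2) (v : Fock par) : tw par q (tw par r v) = tw par (q + r) v := by
  induction v using Fock.ind with
  | one => simp
  | add u v hu hv => simp [hu, hv]
  | smul c u hu => simp [hu]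
  | mul x v hv => simp [hv, ksign_add_left, smul_smul, mul_comm]

@[simp] theorem tw_zero (v : Fock par) : tw par 0 v = v := by
  induction v using Fock.ind with
  | one => simp
  | add u v hu hv => simp [hu, hv]
  | smul c u hu => simp [hu]
  | mul x v hv => simp [hv]

@[simp] theorem tw_tw_self (q : ZMod 2) (v : Fock par) : tw par q (tw par q v) = v := by
  rw [tw_tw, CharTwo.add_self_eq_zero, tw_zero]

theorem tw_comm (q r : ZMod 2) (v : Fock par) :
    tw par q (tw par r v) = tw par r (tw par q v) := by
  rw [tw_tw, tw_tw, add_comm]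

/-- The subspace of vectors of parity `p`. -/
noncomputable def grade (p : ZMod 2) : Submodule ℂ (Fock par) :=
  LinearMap.ker ((tw par 1).toLinearMap - ksign 1 p • LinearMap.id)

theorem mem_grade {p : ZMod 2} {v : Fock par} :
    v ∈ grade par p ↔ tw par 1 v = ksign 1 p • v := by
  simp [grade, sub_eq_zero]

theorem tw_of_mem {p : ZMod 2} {v : Fock par} (h : v ∈ grade par p) (q : ZMod 2) :
    tw par q v = ksign q p • v := by
  rw [mem_grade] at h
  rcases (by revert q; decide : q = 0 ∨ q = 1) with rfl | rfl
  · simp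
  · exact h

theorem isCompl_grade : IsCompl (grade par 0) (grade par 1) := by
  constructor
  · rw [Submodule.disjoint_def]
    intro v h0 h1
    rw [mem_grade] at h0 h1
    rw [h0] at h1
    simp only [ksign_zero_right, one_smul, ksign_one_one] at h1
    have h2 : (2 : ℂ) • v = 0 := by
      rw [two_smul]; nth_rewrite 2 [h1]; exact (by module : v + (-1 : ℂ) • v = 0)
    exact (smul_eq_zero.1 h2).resolve_left two_ne_zero
  · rw [codisjoint_iff, eq_top_iff]
    intro v _
    have : v = (2⁻¹ : ℂ) • (v + tw par 1 v) + (2⁻¹ : ℂ) • (v - tw par 1 v) := by module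
    rw [this]
    refine Submodule.add_mem_sup ?_ ?_
    · rw [mem_grade]; simp [add_comm]
    · rw [mem_grade]; simp only [map_smul, map_sub, tw_tw_self, ksign_one_one]; module

theorem gen_mem (x : Gen A) : gen par x ∈ grade par (x.parity par) := by
  rw [mem_grade, tw_gen]

theorem mul_mem_grade {p q : ZMod 2} {u v : Fock par} (hu : u ∈ grade par p)
    (hv : v ∈ grade par q) : u * v ∈ grade par (p + q) := by
  rw [mem_grade] at *
  rw [map_mul, hu, hv, smul_mul_smul_comm, ksign_add_right]

/-- supercommutativity with a generator -/
theorem mul_gen (x : Gen A) (v : Fock par) :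
    v * gen par x = gen par x * tw par (x.parity par) v := by
  induction v using Fock.ind with
  | one => simp
  | add u v hu hv => simp [hu, hv, add_mul, mul_add]
  | smul c u hu => simp [hu]
  | mul y v hv =>
    rw [mul_assoc, hv, ← mul_assoc, gen_swap, map_mul, tw_gen, ← mul_assoc, ksign_comm]
    simp

theorem Gen.parity_succ (x : Gen A) : x.succ.parity par = x.parity par + 1 := by
  simp [Gen.parity, Gen.succ, add_assoc]


theorem upper_mul {B : Type*} [Ring B] (a b c a' b' c' : B) :
    !![a, b; 0, c] * !![a', b'; 0, c'] = !![a * a', a * b' + b * c'; 0, c * c'] := by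
  simp

theorem upper_smul {B : Type*} [Ring B] [Algebra ℂ B] (k : ℂ) (a b c : B) :
    k • !![a, b; 0, c] = !![k • a, k • b; 0, k • c] := by
  simp [Matrix.smul_of]

theorem upper_swap {B : Type*} [Ring B] [Algebra ℂ B] {k : ℂ} {a b c a' b' c' : B}
    (h1 : a * a' = k • (a' * a)) (h2 : a * b' + b * c' = k • (a' * b + b' * c))
    (h3 : c * c' = k • (c' * c)) :
    !![a, b; 0, c] * !![a', b'; 0, c'] = k • (!![a', b'; 0, c'] * !![a, b; 0, c]) := by
  rw [upper_mul, upper_mul, upper_smul, h1, h2, h3]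

theorem upper_entry {f : Fock par →ₐ[ℂ] Matrix (Fin 2) (Fin 2) (Fock par)}
    {r r' : ZMod 2} {d : Gen A → Fock par}
    (hf : ∀ x, f (gen par x) = !![tw par r (gen par x), d x; 0, tw par r' (gen par x)])
    (v : Fock par) : f v = !![tw par r v, f v 0 1; 0, tw par r' v] := by
  induction v using Fock.ind with
  | one => simp [Matrix.one_fin_two]
  | add u v hu hv => rw [map_add, hu, hv]; simp [Matrix.of_add_of]
  | smul c u hu => rw [map_smul, hu, upper_smul]; simp
  | mul x v hv =>
    rw [map_mul, hv, hf, upper_mul]; simp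

theorem upper_map_mul {f : Fock par →ₐ[ℂ] Matrix (Fin 2) (Fin 2) (Fock par)}
    {r r' : ZMod 2} {d : Gen A → Fock par}
    (hf : ∀ x, f (gen par x) = !![tw par r (gen par x), d x; 0, tw par r' (gen par x)])
    (u v : Fock par) : f (u * v) 0 1 = tw par r u * f v 0 1 + f u 0 1 * tw par r' v := by
  rw [map_mul, upper_entry par hf u, upper_entry par hf v, upper_mul]; simp

/-- Auxiliary homomorphism `v ↦ !![(-1)^v v, D v; 0, v]`, used to define the derivation `D`. -/
noncomputable def dmat : Fock par →ₐ[ℂ] Matrix (Fin 2) (Fin 2) (Fock par) :=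
  lift par (fun x => !![ksign 1 (x.parity par) • gen par x, gen par x.succ; 0, gen par x]) (by
    intro x y
    have h1 := gen_swap par x y
    have h2 := gen_swap par x.succ y
    have h3 := gen_swap par y.succ x
    rw [Gen.parity_succ] at h2 h3
    refine upper_swap ?_ ?_ h1
    · rw [smul_mul_smul_comm, smul_mul_smul_comm, h1, smul_smul, smul_smul]; ring_nf
    · rw [smul_mul_assoc, smul_mul_assoc, h2, h3, ksign_add_left, ksign_add_left,
        ksign_comm (y.parity par) (x.parity par)]
      match_scalars
      · linear_combination - ksign 1 (x.parity par) * ksign_mul_self (x.parity par) (y.parity par)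
      · ring)

/-- The odd derivation `D` with `D (D^n φ) = D^{n+1} φ` for both kinds of generators. -/
noncomputable def D : Fock par →ₗ[ℂ] Fock par where
  toFun v := dmat par v 0 1
  map_add' u v := by simp
  map_smul' c u := by simp

theorem dmat_gen (x : Gen A) : dmat par (gen par x) =
    !![tw par 1 (gen par x), gen par x.succ; 0, tw par 0 (gen par x)] := by
  simp [dmat]

@[simp] theorem D_gen (x : Gen A) : D par (gen par x) = gen par x.succ := by
  change dmat par (gen par x) 0 1 = _
  simp [dmat]

theorem D_mul (u v : Fock par) : D par (u * v) = tw par 1 u * D par v + D par u * v := by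
  have := upper_map_mul par (dmat_gen par) u v
  rwa [tw_zero] at this

@[simp] theorem D_one : D par 1 = 0 := by
  change dmat par 1 0 1 = _
  simp

theorem D_gen_mul (x : Gen A) (v : Fock par) : D par (gen par x * v) =
    ksign 1 (x.parity par) • (gen par x * D par v) + gen par x.succ * v := by
  simp [D_mul]

theorem D_tw (q : ZMod 2) (v : Fock par) : D par (tw par q v) = ksign 1 q • tw par q (D par v) := by
  induction v using Fock.ind with
  | one => simp
  | add u v hu hv => simp [hu, hv]
  | smul c u hu => simp [hu, smul_comm c]
  | mul x v hv =>
    simp only [map_mul, tw_gen, smul_mul_assoc, map_smul, D_gen_mul, hv, Gen.parity_succ, map_add,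
      smul_add, smul_smul, mul_smul_comm, ksign_add_right]
    congr 2
    · ring
    · rw [ksign_comm 1 q]; rw [mul_left_comm, ksign_mul_self, mul_one]

theorem D_mem {p : ZMod 2} {v : Fock par} (h : v ∈ grade par p) : D par v ∈ grade par (p + 1) := by
  rw [mem_grade] at *
  have := D_tw par 1 v
  rw [h, map_smul, ksign_one_one] at this
  rw [ksign_add_right, ksign_one_one, mul_comm, ← smul_smul, this, smul_smul]; simp

/-- The even derivation `D²`. -/
noncomputable def T : Fock par →ₗ[ℂ] Fock par := D par ∘ₗ D par

theorem T_mul (u v : Fock par) : T par (u * v) = u * T par v + T par u * v := by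
  simp only [T, LinearMap.comp_apply, D_mul, map_add, tw_tw_self, D_tw, ksign_one_one]
  rw [smul_mul_assoc]
  module

/-- `D^{2k} = ∂^k` applied to a generator. -/
def Gen.shift (k : ℕ) (x : Gen A) : Gen A := ⟨x.up, x.idx, x.ord + 2 * k⟩

theorem Gen.parity_shift (k : ℕ) (x : Gen A) : (x.shift k).parity par = x.parity par := by
  have : (2 : ZMod 2) = 0 := by decide
  simp [Gen.parity, Gen.shift, this]

theorem T_tw (q : ZMod 2) (v : Fock par) : T par (tw par q v) = tw par q (T par v) := by
  simp [T, D_tw, smul_smul]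

@[simp] theorem T_one : T par 1 = 0 := by simp [T]

theorem T_gen (x : Gen A) : T par (gen par x) = gen par (x.shift 1) := by
  simp [T, Gen.succ, Gen.shift]


/-! ## The modes

The Fourier modes are computed from the plain `n`-th products `a_(n) b = a_(n|1) b`
(`nprod n a b` below), since `a_(n|0) b = (D a)_(n|1) b`.  They are determined by
`Y(a, z)|0⟩ = exp(z∂) a`, that is `a_(n)|0⟩ = ∂^{-n-1} a / (-n-1)!`, and by the commutator formula
`[y_(-1), a_(n)] = ∑_{j ≥ 0} (-1)^j (y_(j) a)_(n-j-1)` for generators `y`, where `y_(-1)` is the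
multiplication by `y`.  In other words
`a_(n) (y b) = (-1)^{ay} y (a_(n) b) + ∑_{j ≥ 0} (rd y j a)_(n-j-1) b`
with `rd y j a = -(-1)^{j+ay} y_(j) a`. -/

/-- The sign in the contraction of two generators. -/
def kcoef (x : Gen A) : ℂ :=
  (-1) ^ (x.ord / 2) * if Even x.ord then -(ksign 1 (x.parity par)) else 1

open Classical in
/-- The contraction `x_(j|1) y` of two generators, a multiple of the vacuum: it is `± j!` if `x`
and `y` are `D^m φ_a` and `D^n φ^{ā}`, in any order, with `m + n = 2j + 1`, and zero otherwise.
It comes from `[φ_a _Λ φ^{b̄}] = δ_{ab}` by sesquilinearity. -/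
noncomputable def kap (x y : Gen A) (j : ℕ) : ℂ :=
  if x.up ≠ y.up ∧ x.idx = y.idx ∧ x.ord + y.ord = 2 * j + 1 then kcoef par x * j.factorial else 0

theorem kap_pos {x y : Gen A} {j : ℕ}
    (h : x.up ≠ y.up ∧ x.idx = y.idx ∧ x.ord + y.ord = 2 * j + 1) :
    kap par x y j = kcoef par x * j.factorial := if_pos h

theorem kap_neg {x y : Gen A} {j : ℕ}
    (h : ¬ (x.up ≠ y.up ∧ x.idx = y.idx ∧ x.ord + y.ord = 2 * j + 1)) :
    kap par x y j = 0 := if_neg h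

theorem natCast_zmod_two (m n j : ℕ) (h : m + n = 2 * j + 1) : (n : ZMod 2) = m + 1 := by
  have h4 : (m : ZMod 2) + n = 1 := by
    have := congrArg (fun n : ℕ => (n : ZMod 2)) h
    have h2 : (2 : ZMod 2) = 0 := by decide
    simpa [h2] using this
  generalize (m : ZMod 2) = a at *
  generalize (n : ZMod 2) = b at *
  revert a b; decide

theorem kpair_parity {x y : Gen A} {j : ℕ}
    (h : x.up ≠ y.up ∧ x.idx = y.idx ∧ x.ord + y.ord = 2 * j + 1) :
    y.parity par = x.parity par := by
  obtain ⟨h1, h2, h3⟩ := h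
  rw [Gen.parity, Gen.parity, natCast_zmod_two _ _ _ h3, h2]
  have h6 : gpar par y.up y.idx = gpar par x.up y.idx + 1 := by
    cases hx : x.up <;> cases hy : y.up <;> simp [hx, hy, gpar] at h1 ⊢
    rw [add_assoc, show (1 : ZMod 2) + 1 = 0 by decide, add_zero]
  rw [h6, add_add_add_comm, show (1 : ZMod 2) + 1 = 0 by decide, add_zero]

theorem kap_parity {x y : Gen A} {j : ℕ} (h : kap par x y j ≠ 0) :
    y.parity par = x.parity par := by
  by_contra h'
  exact h (kap_neg par fun hh => h' (kpair_parity par hh))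

theorem kap_bound (x y : Gen A) (j : ℕ) (h : x.ord + y.ord ≤ j) : kap par x y j = 0 :=
  kap_neg par (by omega)

theorem kcoef_succ (x : Gen A) : kcoef par x.succ = - (ksign 1 (x.parity par) * kcoef par x) := by
  have h := Gen.parity_succ par x
  rw [kcoef, kcoef, h, ksign_add_right, ksign_one_one]
  change (-1) ^ ((x.ord + 1) / 2) * _ = _
  by_cases hx : Even x.ord
  · rw [if_pos hx, if_neg (show ¬ Even x.succ.ord by simpa [Gen.succ, Nat.even_add_one] using hx),
      show (x.ord + 1) / 2 = x.ord / 2 by grind]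
    linear_combination (-1) ^ (x.ord / 2) * (- ksign_mul_self 1 (x.parity par))
  · rw [if_neg hx, if_pos (show Even x.succ.ord by simpa [Gen.succ, Nat.even_add_one] using hx),
      show (x.ord + 1) / 2 = x.ord / 2 + 1 by grind, pow_succ]
    ring

theorem kap_succ (x y : Gen A) (j : ℕ) :
    kap par x.succ y j = - (ksign 1 (x.parity par) * kap par x y.succ j) := by
  by_cases h : x.up ≠ y.up ∧ x.idx = y.idx ∧ x.ord + 1 + y.ord = 2 * j + 1
  · rw [kap_pos par (x := x.succ) (y := y) h, kap_pos par (x := x) (y := y.succ)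
      ⟨h.1, h.2.1, by simp only [Gen.succ]; omega⟩, kcoef_succ]
    ring
  · rw [kap_neg par (x := x.succ) (y := y) h, kap_neg par (x := x) (y := y.succ)]
    · simp
    · rintro ⟨h1, h2, h3⟩
      simp only [Gen.succ] at h3
      exact h ⟨h1, h2, by omega⟩

theorem succ_succ (x : Gen A) : x.succ.succ = x.shift 1 := by
  simp [Gen.succ, Gen.shift]

theorem kap_shift_zero (x y : Gen A) : kap par (x.shift 1) y 0 = 0 := by
  apply kap_neg; simp [Gen.shift]; omega

theorem kap_shift (x y : Gen A) (j : ℕ) :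
    kap par (x.shift 1) y (j + 1) = - ((j + 1 : ℕ) * kap par x y j) := by
  have hk : kcoef par (x.shift 1) = - kcoef par x := by
    rw [← succ_succ, kcoef_succ, kcoef_succ, Gen.parity_succ, ksign_add_right, ksign_one_one]
    linear_combination - kcoef par x * ksign_mul_self 1 (x.parity par)
  by_cases h : x.up ≠ y.up ∧ x.idx = y.idx ∧ x.ord + y.ord = 2 * j + 1
  · rw [kap_pos par h, kap_pos par (x := x.shift 1) (y := y)
      ⟨h.1, h.2.1, by simp only [Gen.shift]; omega⟩, hk, Nat.factorial_succ]
    push_cast; ring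
  · rw [kap_neg par h, kap_neg par (x := x.shift 1) (y := y)]
    · simp
    · rintro ⟨h1, h2, h3⟩
      simp only [Gen.shift] at h3
      exact h ⟨h1, h2, by omega⟩

theorem kap_shift_right_zero (x y : Gen A) : kap par x (y.shift 1) 0 = 0 := by
  apply kap_neg; simp [Gen.shift]; omega

theorem kap_shift_right (x y : Gen A) (j : ℕ) :
    kap par x (y.shift 1) (j + 1) = (j + 1 : ℕ) * kap par x y j := by
  by_cases h : x.up ≠ y.up ∧ x.idx = y.idx ∧ x.ord + y.ord = 2 * j + 1
  · rw [kap_pos par h, kap_pos par (x := x) (y := y.shift 1)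
      ⟨h.1, h.2.1, by simp only [Gen.shift]; omega⟩, Nat.factorial_succ]
    push_cast; ring
  · rw [kap_neg par h, kap_neg par (x := x) (y := y.shift 1)]
    · simp
    · rintro ⟨h1, h2, h3⟩
      simp only [Gen.shift] at h3
      exact h ⟨h1, h2, by omega⟩

theorem ksign_self (p : ZMod 2) : ksign p p = ksign 1 p := by
  rcases (by revert p; decide : p = 0 ∨ p = 1) with rfl | rfl <;> simp

theorem kap_skew (x y : Gen A) (j : ℕ) :
    kap par y x j = - (ksign (x.parity par) (y.parity par) * (-1) ^ j * kap par x y j) := by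
  by_cases h : x.up ≠ y.up ∧ x.idx = y.idx ∧ x.ord + y.ord = 2 * j + 1
  · have hp := kpair_parity par h
    rw [kap_pos par h, kap_pos par (x := y) (y := x)
      ⟨h.1.symm, h.2.1.symm, by omega⟩, hp, ksign_self]
    have e := ksign_mul_self 1 (x.parity par)
    have hj : (-1 : ℂ) ^ j = (-1) ^ (x.ord / 2) * (-1) ^ (y.ord / 2) := by
      rw [← pow_add]; congr 1; grind
    have e1 : ((-1 : ℂ) ^ (x.ord / 2)) * ((-1 : ℂ) ^ (x.ord / 2)) = 1 := by
      rw [← mul_pow]; simp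
    rw [kcoef, kcoef, hp, hj]
    have h3 := h.2.2
    by_cases hx : Even x.ord
    · rw [if_pos hx, if_neg (show ¬ Even y.ord by grind)]
      linear_combination (-1) ^ (y.ord / 2) * (j.factorial : ℂ) * (- ksign 1 (x.parity par) ^ 2 * e1 - e)
    · rw [if_neg hx, if_pos (show Even y.ord by grind)]
      linear_combination (-1) ^ (y.ord / 2) * (j.factorial : ℂ) * (ksign 1 (x.parity par) * e1)
  · rw [kap_neg par h, kap_neg par]
    · simp
    · rintro ⟨h1, h2, h3⟩
      exact h ⟨h1.symm, h2.symm, by omega⟩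

/-- Auxiliary homomorphism used to define `rd`. -/
noncomputable def rdmat (y : Gen A) (j : ℕ) : Fock par →ₐ[ℂ] Matrix (Fin 2) (Fin 2) (Fock par) :=
  lift par (fun x => !![gen par x, kap par x y j • 1; 0,
      ksign (y.parity par) (x.parity par) • gen par x]) (by
    intro x z
    have h1 := gen_swap par x z
    have key : ∀ x z : Gen A, kap par z y j * ksign (y.parity par) (x.parity par) =
        kap par z y j * ksign (z.parity par) (x.parity par) := by
      intro x z
      by_cases h : kap par z y j = 0
      · simp [h]
      · rw [kap_parity par h]
    refine upper_swap h1 ?_ ?_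
    · simp only [mul_smul_comm, smul_mul_assoc, mul_one, one_mul, smul_add, smul_smul]
      have k1 := key x z
      have k2 := key z x
      rw [ksign_comm (z.parity par) (x.parity par)] at k1
      match_scalars
      · linear_combination - ksign (x.parity par) (z.parity par) * k1 -
          kap par z y j * ksign_mul_self (x.parity par) (z.parity par)
      · linear_combination k2
    · rw [smul_mul_smul_comm, smul_mul_smul_comm, h1, smul_smul, smul_smul]; ring_nf)

/-- The contraction of `a` with a generator `y`: the right superderivation of the same parity as `y`
determined by its values `kap x y j` on the generators `x`.  One has
`rd y j a = -(-1)^{j+ay} y_(j|1) a`, see `rd_tw_self`. -/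
noncomputable def rd (y : Gen A) (j : ℕ) : Fock par →ₗ[ℂ] Fock par where
  toFun v := rdmat par y j v 0 1
  map_add' u v := by simp
  map_smul' c u := by simp

theorem rdmat_gen (y : Gen A) (j : ℕ) (x : Gen A) : rdmat par y j (gen par x) =
    !![tw par 0 (gen par x), kap par x y j • 1; 0, tw par (y.parity par) (gen par x)] := by
  simp [rdmat]

theorem rd_mul (y : Gen A) (j : ℕ) (u v : Fock par) :
    rd par y j (u * v) = u * rd par y j v + rd par y j u * tw par (y.parity par) v := by
  have := upper_map_mul par (rdmat_gen par y j) u v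
  rwa [tw_zero] at this

@[simp] theorem rd_gen (y : Gen A) (j : ℕ) (x : Gen A) :
    rd par y j (gen par x) = kap par x y j • 1 := by
  change rdmat par y j (gen par x) 0 1 = _
  simp [rdmat]

@[simp] theorem rd_one (y : Gen A) (j : ℕ) : rd par y j 1 = 0 := by
  change rdmat par y j 1 0 1 = _
  simp

theorem rd_gen_mul (y : Gen A) (j : ℕ) (x : Gen A) (v : Fock par) : rd par y j (gen par x * v) =
    gen par x * rd par y j v + kap par x y j • tw par (y.parity par) v := by
  simp [rd_mul]

theorem rd_tw (y : Gen A) (j : ℕ) (q : ZMod 2) (v : Fock par) :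
    rd par y j (tw par q v) = ksign q (y.parity par) • tw par q (rd par y j v) := by
  induction v using Fock.ind with
  | one => simp
  | add u v hu hv => simp [hu, hv]
  | smul c u hu => simp [hu, smul_comm c]
  | mul x v hv =>
    simp only [map_mul, tw_gen, smul_mul_assoc, map_smul, rd_gen_mul, hv, map_add,
      smul_add, smul_smul, mul_smul_comm]
    congr 1
    · rw [mul_comm]
    · by_cases h : kap par x y j = 0
      · simp [h]
      · rw [kap_parity par h, tw_comm, mul_comm]

theorem rd_bound (y : Gen A) (v : Fock par) : ∃ J, ∀ j, J ≤ j → rd par y j v = 0 := by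
  induction v using Fock.ind with
  | one => exact ⟨0, by simp⟩
  | add u v hu hv =>
    obtain ⟨J, hJ⟩ := hu
    obtain ⟨K, hK⟩ := hv
    exact ⟨max J K, fun j hj => by
      rw [map_add, hJ j (le_of_max_le_left hj), hK j (le_of_max_le_right hj), add_zero]⟩
  | smul c u hu =>
    obtain ⟨J, hJ⟩ := hu
    exact ⟨J, fun j hj => by rw [map_smul, hJ j hj, smul_zero]⟩
  | mul x v hv =>
    obtain ⟨J, hJ⟩ := hv
    refine ⟨max J (x.ord + y.ord), fun j hj => ?_⟩
    rw [rd_gen_mul, hJ j (le_of_max_le_left hj), kap_bound par x y j (le_of_max_le_right hj)]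
    simp

theorem rd_rd (y z : Gen A) (i j : ℕ) (v : Fock par) : rd par y i (rd par z j v) =
    ksign (y.parity par) (z.parity par) • rd par z j (rd par y i v) := by
  induction v using Fock.ind with
  | one => simp
  | add u v hu hv => simp [hu, hv]
  | smul c u hu => simp [hu, smul_comm c]
  | mul x v hv =>
    simp only [rd_gen_mul, map_add, map_smul, hv, rd_tw, smul_add, smul_smul, mul_smul_comm]
    rw [ksign_comm (z.parity par) (y.parity par)]
    match_scalars
    · ring
    · linear_combination (-kap par x y i) * ksign_mul_self (y.parity par) (z.parity par)
    · ring

theorem rd_D (y : Gen A) (j : ℕ) (v : Fock par) : rd par y j (D par v) =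
    D par (rd par y j v) - rd par y.succ j (tw par 1 v) := by
  induction v using Fock.ind with
  | one => simp
  | add u v hu hv => simp only [map_add, hu, hv]; abel
  | smul c u hu => simp only [map_smul, hu, smul_sub]
  | mul x v hv =>
    simp only [D_gen_mul, rd_gen_mul, map_add, map_smul, hv, kap_succ, Gen.parity_succ, tw_gen, map_mul,
      smul_mul_assoc, tw_tw, D_tw]
    rw [show y.parity par + 1 + 1 = y.parity par by
      rw [add_assoc, show (1 : ZMod 2) + 1 = 0 by decide, add_zero]]
    have e : kap par x y j * ksign 1 (y.parity par) = kap par x y j * ksign 1 (x.parity par) := by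
      by_cases h : kap par x y j = 0
      · simp [h]
      · rw [kap_parity par h]
    simp only [mul_sub, smul_add, smul_sub, smul_smul, e]
    module

theorem rd_T_zero (y : Gen A) (v : Fock par) : rd par y 0 (T par v) = T par (rd par y 0 v) := by
  induction v using Fock.ind with
  | one => simp
  | add u v hu hv => simp only [map_add, hu, hv]
  | smul c u hu => simp only [map_smul, hu]
  | mul x v hv =>
    simp only [T_mul, T_gen, rd_gen_mul, map_add, map_smul, hv, kap_shift_zero, T_tw]
    module

theorem rd_T_succ (y : Gen A) (j : ℕ) (v : Fock par) : rd par y (j + 1) (T par v) =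
    T par (rd par y (j + 1) v) - (j + 1 : ℂ) • rd par y j v := by
  induction v using Fock.ind with
  | one => simp
  | add u v hu hv => simp only [map_add, hu, hv]; module
  | smul c u hu => simp only [map_smul, hu]; module
  | mul x v hv =>
    simp only [T_mul, T_gen, rd_gen_mul, map_add, map_smul, hv, kap_shift, T_tw, mul_sub,
      mul_smul_comm]
    push_cast
    module


section Sums
variable {V W : Type*} [AddCommGroup V] [Module ℂ V] [AddCommGroup W] [Module ℂ W]

/-- A sequence is eventually zero. -/
def EZ (f : ℕ → V) : Prop := ∃ K, ∀ k, K ≤ k → f k = 0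

/-- The sum of an eventually zero sequence. -/
noncomputable def esum (f : ℕ → V) : V := ∑ᶠ k, f k

theorem EZ.finite {f : ℕ → V} (hf : EZ f) : (Function.support f).Finite := by
  obtain ⟨K, hK⟩ := hf
  refine (Finset.range K).finite_toSet.subset fun k hk => ?_
  by_contra h
  exact hk (hK k (by simpa using h))

theorem esum_zero : esum (fun _ => (0 : V)) = 0 := finsum_zero

theorem esum_eq_zero {f : ℕ → V} (h : ∀ k, f k = 0) : esum f = 0 := by
  rw [show f = fun _ => 0 from funext h, esum_zero]

theorem EZ.zero : EZ (fun _ => (0 : V)) := ⟨0, fun _ _ => rfl⟩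

theorem EZ.add {f g : ℕ → V} (hf : EZ f) (hg : EZ g) : EZ (fun k => f k + g k) := by
  obtain ⟨J, hJ⟩ := hf
  obtain ⟨K, hK⟩ := hg
  exact ⟨max J K, fun j hj => by
    simp only [hJ j (le_of_max_le_left hj), hK j (le_of_max_le_right hj), add_zero]⟩

theorem EZ.map {f : ℕ → V} (hf : EZ f) (g : ℕ → V → W) (hg : ∀ k, g k 0 = 0) :
    EZ (fun k => g k (f k)) := by
  obtain ⟨J, hJ⟩ := hf
  exact ⟨J, fun j hj => by simp only [hJ j hj, hg]⟩

theorem EZ.smul {f : ℕ → V} (hf : EZ f) (c : ℕ → ℂ) : EZ (fun k => c k • f k) :=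
  hf.map (fun k v => c k • v) (by simp)

theorem EZ.sub {f g : ℕ → V} (hf : EZ f) (hg : EZ g) : EZ (fun k => f k - g k) := by
  simpa [sub_eq_add_neg] using hf.add (hg.map (fun _ v => -v) (by simp))

theorem EZ.succ {f : ℕ → V} (hf : EZ f) : EZ (fun k => f (k + 1)) := by
  obtain ⟨J, hJ⟩ := hf
  exact ⟨J, fun j hj => hJ _ (by omega)⟩

theorem EZ.sum {ι : Type*} (s : Finset ι) {f : ι → ℕ → V} (hf : ∀ i ∈ s, EZ (f i)) :
    EZ (fun k => ∑ i ∈ s, f i k) := by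
  classical
  induction s using Finset.induction_on with
  | empty => simpa using EZ.zero
  | insert a s ha ih =>
    simp only [Finset.sum_insert ha]
    exact (hf a (by simp)).add (ih fun i hi => hf i (by simp [hi]))

theorem esum_add {f g : ℕ → V} (hf : EZ f) (hg : EZ g) :
    esum (fun k => f k + g k) = esum f + esum g := finsum_add_distrib hf.finite hg.finite

theorem esum_sub {f g : ℕ → V} (hf : EZ f) (hg : EZ g) :
    esum (fun k => f k - g k) = esum f - esum g := finsum_sub_distrib hf.finite hg.finite

theorem map_esum {f : ℕ → V} (hf : EZ f) (g : V →ₗ[ℂ] W) :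
    g (esum f) = esum (fun k => g (f k)) := by
  exact AddMonoidHom.map_finsum g.toAddMonoidHom hf.finite

theorem smul_esum (f : ℕ → V) (hf : EZ f) (c : ℂ) : c • esum f = esum (fun k => c • f k) :=
  map_esum hf (c • LinearMap.id)

theorem esum_eq_sum {f : ℕ → V} {K : ℕ} (h : ∀ k, K ≤ k → f k = 0) :
    esum f = ∑ k ∈ Finset.range K, f k := by
  refine finsum_eq_sum_of_support_subset _ fun k hk => ?_
  by_contra h'
  exact hk (h k (by simpa using h'))

theorem esum_single {f : ℕ → V} (i : ℕ) (h : ∀ k, k ≠ i → f k = 0) : esum f = f i :=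
  finsum_eq_single _ _ h

theorem esum_succ {f : ℕ → V} (hf : EZ f) : esum f = f 0 + esum (fun k => f (k + 1)) := by
  obtain ⟨K, hK⟩ := hf
  rw [esum_eq_sum (K := K + 1) (fun k hk => hK k (by omega)),
    esum_eq_sum (K := K) (fun k hk => hK (k + 1) (by omega)), Finset.sum_range_succ', add_comm]

theorem esum_sum {ι : Type*} (s : Finset ι) {f : ι → ℕ → V} (hf : ∀ i ∈ s, EZ (f i)) :
    esum (fun k => ∑ i ∈ s, f i k) = ∑ i ∈ s, esum (f i) := by
  classical
  induction s using Finset.induction_on with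
  | empty => simpa using esum_zero
  | insert a s ha ih =>
    simp only [Finset.sum_insert ha]
    rw [esum_add (hf a (by simp)) (EZ.sum s fun i hi => hf i (by simp [hi])),
      ih fun i hi => hf i (by simp [hi])]

end Sums

/-- `a_(n)|0⟩`: it is `∂^k a / k!` for `n = -k-1 < 0`, and zero for `n ≥ 0`. -/
noncomputable def base : ℤ → Fock par →ₗ[ℂ] Fock par
  | Int.ofNat _ => 0
  | Int.negSucc k => ((k.factorial : ℂ)⁻¹) • (T par) ^ k

theorem contr_EZ (y : Gen A) (Z : ℤ → Fock par →ₗ[ℂ] Fock par) (n : ℤ) (a : Fock par) :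
    EZ (fun j : ℕ => Z (n - j - 1) (rd par y j a)) :=
  EZ.map (rd_bound par y a) (fun j v => Z (n - j - 1) v) (by simp)

/-- The recursion: if `Z n a = a_(n) b`, then `step y Z n a = a_(n) (y b)`, that is
`a_(n) (y b) = y ((-1)^{ay} a_(n) b) + ∑_{j ≥ 0} (rd y j a)_(n-j-1) b`. -/
noncomputable def step (y : Gen A) : Module.End ℂ (ℤ → Fock par →ₗ[ℂ] Fock par) where
  toFun Z n :=
    { toFun := fun a => gen par y * Z n (tw par (y.parity par) a) +
        esum fun j : ℕ => Z (n - j - 1) (rd par y j a)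
      map_add' := fun a b => by
        simp only [map_add, mul_add]
        rw [esum_add (contr_EZ par y Z n a) (contr_EZ par y Z n b)]
        abel
      map_smul' := fun c a => by
        simp only [map_smul, mul_smul_comm, smul_add, RingHom.id_apply]
        rw [smul_esum _ (contr_EZ par y Z n a)] }
  map_add' Z Z' := by
    funext n
    ext a
    simp only [Pi.add_apply, LinearMap.add_apply, LinearMap.coe_mk, AddHom.coe_mk, mul_add]
    rw [esum_add (contr_EZ par y Z n a) (contr_EZ par y Z' n a)]
    abel
  map_smul' c Z := by
    funext n
    ext a
    simp only [Pi.smul_apply, LinearMap.smul_apply, LinearMap.coe_mk, AddHom.coe_mk, mul_smul_comm,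
      smul_add, RingHom.id_apply]
    rw [smul_esum _ (contr_EZ par y Z n a)]

theorem step_apply (y : Gen A) (Z : ℤ → Fock par →ₗ[ℂ] Fock par) (n : ℤ) (a : Fock par) :
    step par y Z n a = gen par y * Z n (tw par (y.parity par) a) +
      esum fun j : ℕ => Z (n - j - 1) (rd par y j a) := rfl

theorem step_swap (y z : Gen A) : step par y * step par z =
    ksign (y.parity par) (z.parity par) • (step par z * step par y) := by
  refine LinearMap.ext fun Z => funext fun n => LinearMap.ext fun a => ?_
  change step par y (step par z Z) n a = ksign (y.parity par) (z.parity par) •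
    step par z (step par y Z) n a
  simp only [step_apply, mul_add]
  obtain ⟨J, hJ⟩ := rd_bound par y a
  obtain ⟨K, hK⟩ := rd_bound par z a
  have m : ∀ (y : Gen A) (f : ℕ → Fock par), EZ f → gen par y * esum f = esum fun k => gen par y * f k :=
    fun y f hf => map_esum hf (LinearMap.mulLeft ℂ (gen par y))
  have c2 : ∀ y z : Gen A, EZ fun j : ℕ => esum fun i : ℕ => 
      Z (n - j - 1 - i - 1) (rd par z i (rd par y j a)) := fun y z =>
    EZ.map (rd_bound par y a) (fun j w => esum fun i : ℕ => Z (n - j - 1 - i - 1) (rd par z i w))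
      (by simp [esum_zero])
  have c1 : ∀ y z : Gen A, EZ fun j : ℕ => gen par z * Z (n - j - 1) (tw par (z.parity par) (rd par y j a)) :=
    fun y z => EZ.map (rd_bound par y a)
      (fun j w => gen par z * Z (n - j - 1) (tw par (z.parity par) w)) (by simp)
  rw [m y _ (contr_EZ par z Z n _), m z _ (contr_EZ par y Z n _), esum_add (c1 y z) (c2 y z),
    esum_add (c1 z y) (c2 z y)]
  have dbl : (esum fun j : ℕ => esum fun i : ℕ => Z (n - j - 1 - i - 1) (rd par z i (rd par y j a))) =
      ksign (y.parity par) (z.parity par) •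
        esum fun j : ℕ => esum fun i : ℕ => Z (n - j - 1 - i - 1) (rd par y i (rd par z j a)) := by
    have e1 : (esum fun j : ℕ => esum fun i : ℕ => Z (n - j - 1 - i - 1) (rd par z i (rd par y j a))) =
        ∑ j ∈ Finset.range J, ∑ i ∈ Finset.range K,
          Z (n - j - 1 - i - 1) (rd par z i (rd par y j a)) := by
      rw [esum_eq_sum (K := J) fun j hj => by simp [hJ j hj, esum_zero]]
      refine Finset.sum_congr rfl fun j _ => esum_eq_sum fun i hi => ?_
      rw [rd_rd, hK i hi]; simp
    have e2 : (esum fun j : ℕ => esum fun i : ℕ => Z (n - j - 1 - i - 1) (rd par y i (rd par z j a))) =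
        ∑ j ∈ Finset.range K, ∑ i ∈ Finset.range J,
          Z (n - j - 1 - i - 1) (rd par y i (rd par z j a)) := by
      rw [esum_eq_sum (K := K) fun j hj => by simp [hK j hj, esum_zero]]
      refine Finset.sum_congr rfl fun j _ => esum_eq_sum fun i hi => ?_
      rw [rd_rd, hJ i hi]; simp
    rw [e1, e2, Finset.sum_comm, Finset.smul_sum]
    refine Finset.sum_congr rfl fun j _ => ?_
    rw [Finset.smul_sum]
    refine Finset.sum_congr rfl fun i _ => ?_
    rw [rd_rd par z y, map_smul, ksign_comm (z.parity par)]
    congr 3; ring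
  rw [dbl]
  have hs : ∀ y z : Gen A, (esum fun k : ℕ => gen par y * Z (n - k - 1) (rd par z k (tw par (y.parity par) a))) =
      ksign (y.parity par) (z.parity par) •
        esum fun k : ℕ => gen par y * Z (n - k - 1) (tw par (y.parity par) (rd par z k a)) := by
    intro y z
    rw [smul_esum _ (c1 z y)]
    simp only [rd_tw, map_smul, mul_smul_comm]
  rw [hs y z, hs z y, tw_comm, ← mul_assoc, ← mul_assoc, gen_swap par y z,
    ksign_comm (z.parity par) (y.parity par), smul_mul_assoc]
  match_scalars
  · ring
  · ring
  · linear_combination - ksign_mul_self (y.parity par) (z.parity par)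
  · ring

/-- The recursion over an arbitrary second argument. -/
noncomputable def stepHom : Fock par →ₐ[ℂ] Module.End ℂ (ℤ → Fock par →ₗ[ℂ] Fock par) :=
  lift par (step par) (step_swap par)

/-- The `n`-th product `a_(n) b = a_(n|1) b`; see `nprod_one_right` and `nprod_gen_mul` for its
characterization. -/
noncomputable def nprod (n : ℤ) : Fock par →ₗ[ℂ] Fock par →ₗ[ℂ] Fock par :=
  LinearMap.flip ((LinearMap.proj n ∘ₗ LinearMap.applyₗ (base par)) ∘ₗ (stepHom par).toLinearMap)

theorem nprod_apply (n : ℤ) (a b : Fock par) : nprod par n a b = stepHom par b (base par) n a := rfl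

theorem nprod_one_right (n : ℤ) (a : Fock par) : nprod par n a 1 = base par n a := by
  simp [nprod_apply]

theorem nprod_gen_mul (n : ℤ) (a : Fock par) (y : Gen A) (b : Fock par) :
    nprod par n a (gen par y * b) = gen par y * nprod par n (tw par (y.parity par) a) b +
      esum fun j : ℕ => nprod par (n - j - 1) (rd par y j a) b := by
  simp only [nprod_apply, map_mul, stepHom, lift_gen]
  rfl


theorem base_nonneg {n : ℤ} (hn : 0 ≤ n) (a : Fock par) : base par n a = 0 := by
  obtain ⟨k, rfl⟩ := Int.eq_ofNat_of_zero_le hn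
  rfl

theorem base_negSucc (k : ℕ) (a : Fock par) :
    base par (Int.negSucc k) a = ((k.factorial : ℂ)⁻¹) • ((T par) ^ k) a := rfl

theorem base_neg_one (a : Fock par) : base par (-1) a = a := by
  have := base_negSucc par 0 a
  simpa using this

theorem T_base (n : ℤ) (a : Fock par) : T par (base par n a) = base par n (T par a) := by
  cases n with
  | ofNat k => simp [base]
  | negSucc k =>
    rw [base_negSucc, base_negSucc, map_smul, ← Module.End.mul_apply, ← pow_succ', pow_succ,
      Module.End.mul_apply]

theorem base_T (n : ℤ) (a : Fock par) :
    base par n (T par a) = -(n : ℂ) • base par (n - 1) a := by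
  cases n with
  | ofNat k =>
    cases k with
    | zero => simp [base]
    | succ k =>
      rw [base_nonneg par (n := Int.ofNat (k + 1)) (Int.natCast_nonneg _), base_nonneg par (by simp),
        smul_zero]
  | negSucc k =>
    have h : Int.negSucc k - 1 = Int.negSucc (k + 1) := by omega
    rw [h, base_negSucc, base_negSucc, ← Module.End.mul_apply, ← pow_succ, smul_smul,
      Nat.factorial_succ]
    congr 1
    have : ((k : ℂ) + 1) ≠ 0 := Nat.cast_add_one_ne_zero k
    have := Nat.cast_ne_zero (R := ℂ).2 k.factorial_ne_zero
    push_cast [Int.cast_negSucc]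
    field_simp

theorem D_base (n : ℤ) (a : Fock par) : D par (base par n a) = base par n (D par a) := by
  cases n with
  | ofNat k => simp [base]
  | negSucc k =>
    rw [base_negSucc, base_negSucc, map_smul]
    congr 1
    have : Commute (D par : Module.End ℂ (Fock par)) (T par) := by
      change D par * (D par * D par) = (D par * D par) * D par
      rw [mul_assoc]
    have := this.pow_right k
    exact LinearMap.congr_fun this.eq a

theorem tw_base (q : ZMod 2) (n : ℤ) (a : Fock par) :
    tw par q (base par n a) = base par n (tw par q a) := by
  cases n with
  | ofNat k => simp [base]
  | negSucc k =>
    rw [base_negSucc, base_negSucc, map_smul]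
    congr 1
    induction k with
    | zero => simp
    | succ k ih => rw [pow_succ', Module.End.mul_apply, Module.End.mul_apply, ← ih, T_tw]

theorem base_one {n : ℤ} (hn : n ≠ -1) : base par n 1 = 0 := by
  cases n with
  | ofNat k => simp [base]
  | negSucc k =>
    cases k with
    | zero => exact absurd rfl hn
    | succ k => rw [base_negSucc, pow_succ, Module.End.mul_apply, T_one]; simp

theorem contrP_EZ (y : Gen A) (n : ℤ) (a b : Fock par) :
    EZ (fun j : ℕ => nprod par (n - j - 1) (rd par y j a) b) :=
  EZ.map (rd_bound par y a) (fun j v => nprod par (n - j - 1) v b) (by simp)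

theorem nprod_one_left (n : ℤ) (b : Fock par) :
    nprod par n 1 b = if n = -1 then b else 0 := by
  induction b using Fock.ind with
  | one =>
    rw [nprod_one_right]
    split_ifs with h
    · rw [h, base_neg_one]
    · exact base_one par h
  | add u v hu hv => rw [map_add, hu, hv]; split_ifs <;> simp
  | smul c u hu => rw [map_smul, hu]; split_ifs <;> simp
  | mul y b hb =>
    rw [nprod_gen_mul, map_one, hb, esum_eq_zero (by simp)]
    split_ifs <;> simp

theorem nprod_bound (b a : Fock par) : ∃ N : ℤ, ∀ n, N ≤ n → nprod par n a b = 0 := by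
  induction b using Fock.ind generalizing a with
  | one => exact ⟨0, fun n hn => by rw [nprod_one_right, base_nonneg par hn]⟩
  | add u v hu hv =>
    obtain ⟨J, hJ⟩ := hu a
    obtain ⟨K, hK⟩ := hv a
    exact ⟨max J K, fun j hj => by
      rw [map_add, hJ j (le_of_max_le_left hj), hK j (le_of_max_le_right hj), add_zero]⟩
  | smul c u hu =>
    obtain ⟨J, hJ⟩ := hu a
    exact ⟨J, fun j hj => by rw [map_smul, hJ j hj, smul_zero]⟩
  | mul y b hb =>
    obtain ⟨N, hN⟩ := hb (tw par (y.parity par) a)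
    obtain ⟨J, hJ⟩ := rd_bound par y a
    choose M hM using fun j : ℕ => hb (rd par y j a)
    have hfin : ∃ B : ℤ, ∀ j < J, M j + j + 1 ≤ B := by
      clear hJ
      induction J with
      | zero => exact ⟨0, by simp⟩
      | succ J ih =>
        obtain ⟨B, hB⟩ := ih
        refine ⟨max B (M J + J + 1), fun j hj => ?_⟩
        rcases Nat.lt_succ_iff_lt_or_eq.1 hj with h | rfl
        · exact (hB j h).trans (le_max_left _ _)
        · exact le_max_right _ _
    obtain ⟨B, hB⟩ := hfin
    refine ⟨max N B, fun n hn => ?_⟩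
    rw [nprod_gen_mul, hN n (le_of_max_le_left hn), mul_zero, zero_add]
    refine esum_eq_zero fun j => ?_
    by_cases hj : j < J
    · refine hM j _ ?_
      have := hB j hj
      have := le_of_max_le_right hn
      omega
    · rw [hJ j (by omega)]; simp

theorem nprod_EZ (n : ℤ) (a b : Fock par) : EZ (fun k : ℕ => nprod par (n + k) a b) := by
  obtain ⟨N, hN⟩ := nprod_bound par b a
  exact ⟨(N - n).toNat, fun k hk => hN _ (by omega)⟩

theorem nprod_tw (q : ZMod 2) (n : ℤ) (a b : Fock par) :
    tw par q (nprod par n a b) = nprod par n (tw par q a) (tw par q b) := by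
  induction b using Fock.ind generalizing a n with
  | one => rw [map_one (tw par q), nprod_one_right, nprod_one_right, tw_base]
  | add u v hu hv => simp only [map_add, hu, hv]
  | smul c u hu => simp only [map_smul, hu]
  | mul y b hb =>
    have := map_esum (contrP_EZ par y n a b) (tw par q).toLinearMap
    simp only [AlgHom.toLinearMap_apply] at this
    rw [nprod_gen_mul, map_add, this]
    simp only [hb]
    rw [map_mul, map_mul, tw_gen, smul_mul_assoc, smul_mul_assoc, map_smul, nprod_gen_mul, hb,
      smul_add, tw_comm, smul_esum _ (contrP_EZ par y n _ _)]
    simp only [rd_tw, map_smul, LinearMap.smul_apply, smul_smul, ksign_mul_self, one_smul]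

theorem nprod_T (n : ℤ) (a b : Fock par) :
    nprod par n (T par a) b = -(n : ℂ) • nprod par (n - 1) a b := by
  induction b using Fock.ind generalizing a n with
  | one => rw [nprod_one_right, nprod_one_right, base_T]
  | add u v hu hv => simp only [map_add, hu, hv, smul_add]
  | smul c u hu => simp only [map_smul, hu, smul_comm c]
  | mul y b hb =>
    rw [nprod_gen_mul, nprod_gen_mul, ← T_tw, hb, mul_smul_comm, smul_add]
    congr 1
    have z1 := contrP_EZ par y n (T par a) b
    have z2 := contrP_EZ par y (n - 1) a b
    have e0 : ∀ j : ℕ, nprod par (n - j - 1) (rd par y j (T par a)) b =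
        nprod par (n - j - 1) (T par (rd par y j a)) b - 
        (j : ℂ) • nprod par (n - j - 1) (rd par y (j - 1) a) b := by
      intro j
      cases j with
      | zero => simp [rd_T_zero]
      | succ j => 
        rw [rd_T_succ, map_sub, LinearMap.sub_apply, map_smul, LinearMap.smul_apply]
        simp
    have z3 : EZ fun j : ℕ => (j : ℂ) • nprod par (n - j - 1) (rd par y (j - 1) a) b := by
      obtain ⟨J, hJ⟩ := rd_bound par y a
      exact ⟨J + 1, fun j hj => by simp only [hJ (j - 1) (by omega), map_zero, LinearMap.zero_apply, smul_zero]⟩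
    have z4 : EZ fun j : ℕ => nprod par (n - j - 1) (T par (rd par y j a)) b := 
      EZ.map (rd_bound par y a) (fun j v => nprod par (n - j - 1) (T par v) b) (by simp)
    simp only [e0]
    rw [esum_sub z4 z3, esum_succ z3, smul_esum _ z2]
    simp only [hb, Nat.cast_zero, zero_smul, zero_add]
    rw [← esum_sub (by simpa only [hb] using z4) z3.succ]
    congr 1
    funext j
    have e1 : n - ((j + 1 : ℕ) : ℤ) - 1 = n - j - 1 - 1 := by push_cast; ring
    have e2 : n - 1 - (j : ℤ) - 1 = n - j - 1 - 1 := by ring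
    rw [e1, e2, Nat.add_sub_cancel]
    push_cast
    module

theorem nprod_D (n : ℤ) (a b : Fock par) : D par (nprod par n a b) =
    nprod par n (tw par 1 a) (D par b) + nprod par n (D par a) b := by
  induction b using Fock.ind generalizing a n with
  | one => simp only [nprod_one_right, D_one, map_zero, zero_add, D_base]
  | add u v hu hv => simp only [map_add, hu, hv]; abel
  | smul c u hu => simp only [map_smul, hu, smul_add]
  | mul y b hb =>
    have z := fun a b n => contrP_EZ par y n a b
    have z' := fun a b n => contrP_EZ par y.succ n a b
    rw [nprod_gen_mul, map_add, D_gen_mul, map_esum (z a b n), D_gen_mul, map_add, map_smul,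
      nprod_gen_mul, nprod_gen_mul, nprod_gen_mul, hb, Gen.parity_succ,
      tw_tw par (y.parity par + 1) 1,
      show y.parity par + 1 + 1 = y.parity par by
        rw [add_assoc, show (1 : ZMod 2) + 1 = 0 by decide, add_zero], tw_comm par _ 1]
    have w1 : EZ fun j : ℕ => nprod par (n - j - 1) (tw par 1 (rd par y j a)) (D par b) :=
      EZ.map (rd_bound par y a) (fun j v => nprod par (n - j - 1) (tw par 1 v) _) (by simp)
    have w2 : EZ fun j : ℕ => nprod par (n - j - 1) (D par (rd par y j a)) b :=
      EZ.map (rd_bound par y a) (fun j v => nprod par (n - j - 1) (D par v) _) (by simp)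
    simp only [hb, rd_D, rd_tw, map_sub, map_smul, LinearMap.sub_apply, LinearMap.smul_apply,
      D_tw, mul_smul_comm]
    rw [esum_add w1 w2, esum_sub w2 (by simpa [rd_tw] using z' (tw par 1 a) b n),
      ← smul_esum _ w1, mul_add]
    have := ksign_mul_self 1 (y.parity par)
    simp only [mul_smul_comm, smul_add, smul_smul, this, one_smul]
    abel

/-- The contraction `kap`, extended by zero to negative indices. -/
noncomputable def kapZ (x y : Gen A) : ℤ → ℂ
  | Int.ofNat j => kap par x y j
  | Int.negSucc _ => 0

theorem kapZ_parity {x y : Gen A} {n : ℤ} (h : kapZ par x y n ≠ 0) :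
    y.parity par = x.parity par := by
  cases n with
  | ofNat k => exact kap_parity par h
  | negSucc k => exact absurd rfl h

theorem nprod_gen_gen_mul (n : ℤ) (x y : Gen A) (b : Fock par) :
    nprod par n (gen par x) (gen par y * b) =
      ksign (x.parity par) (y.parity par) • (gen par y * nprod par n (gen par x) b) +
        kapZ par x y n • b := by
  rw [nprod_gen_mul, tw_gen, map_smul, LinearMap.smul_apply, mul_smul_comm,
    ksign_comm (y.parity par)]
  congr 1
  simp only [rd_gen, map_smul, LinearMap.smul_apply, nprod_one_left]
  cases n with
  | ofNat k =>
    rw [esum_single k]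
    · simp [kapZ]
    · intro j hj
      rw [if_neg, smul_zero]
      simp only [Int.ofNat_eq_natCast]; omega
  | negSucc k =>
    rw [esum_eq_zero]
    · simp [kapZ]
    · intro j
      rw [if_neg, smul_zero]
      omega

theorem Gen.shift_shift (k l : ℕ) (x : Gen A) : (x.shift k).shift l = x.shift (k + l) := by
  simp [Gen.shift, mul_add, add_assoc]

theorem Gen.shift_zero (x : Gen A) : x.shift 0 = x := rfl

theorem T_pow_gen (k : ℕ) (x : Gen A) : ((T par) ^ k) (gen par x) = gen par (x.shift k) := by
  induction k with
  | zero => simp [Gen.shift_zero]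
  | succ k ih => rw [pow_succ', Module.End.mul_apply, ih, T_gen, Gen.shift_shift]

/-- The vector `∂^k x / k!` of a generator `x`. -/
noncomputable def cre (k : ℕ) (x : Gen A) : Fock par := ((k.factorial : ℂ)⁻¹) • gen par (x.shift k)

theorem nprod_negSucc_gen (k : ℕ) (x : Gen A) (b : Fock par) :
    nprod par (Int.negSucc k) (gen par x) b = cre par k x * b := by
  induction b using Fock.ind with
  | one => rw [nprod_one_right, base_negSucc, T_pow_gen, mul_one, cre]
  | add u v hu hv => rw [map_add, hu, hv, mul_add]
  | smul c u hu => rw [map_smul, hu, mul_smul_comm]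
  | mul y b hb =>
    rw [nprod_gen_gen_mul, hb, cre, smul_mul_assoc, smul_mul_assoc, ← mul_assoc, gen_swap par (x.shift k) y,
      Gen.parity_shift, mul_smul_comm, smul_mul_assoc, mul_assoc, smul_comm]
    simp [kapZ]

theorem T_cre (k : ℕ) (x : Gen A) : T par (cre par k x) = (k + 1 : ℂ) • cre par (k + 1) x := by
  rw [cre, cre, map_smul, T_gen, Gen.shift_shift, smul_smul, Nat.factorial_succ]
  congr 1
  have : ((k : ℂ) + 1) ≠ 0 := Nat.cast_add_one_ne_zero k
  have := Nat.cast_ne_zero (R := ℂ).2 k.factorial_ne_zero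
  push_cast
  field_simp

theorem nprod_gen_one {l : ℤ} (hl : 0 ≤ l) (x : Gen A) : nprod par l (gen par x) 1 = 0 := by
  rw [nprod_one_right, base_nonneg par hl]

theorem gen_EZ (x : Gen A) (b : Fock par) : EZ (fun l : ℕ => nprod par l (gen par x) b) := by
  simpa using nprod_EZ par 0 (gen par x) b

theorem base_EZ (n : ℤ) (a : Fock par) : EZ (fun k : ℕ => base par (n + k) a) := by
  simpa only [nprod_one_right] using nprod_EZ par n a 1

theorem base_gen_mul (n : ℤ) (x : Gen A) (a : Fock par) : base par n (gen par x * a) =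
    esum fun k : ℕ => cre par k x * base par (n + k) a := by
  cases n with
  | ofNat n =>
    rw [base_nonneg par (by simp), esum_eq_zero]
    intro k
    rw [base_nonneg par (by simp; omega), mul_zero]
  | negSucc m =>
    induction m with
    | zero =>
      rw [esum_single 0]
      · simp [cre, base_neg_one, Gen.shift_zero]
      · intro k hk
        rw [base_nonneg par (by omega), mul_zero]
    | succ m ih =>
      have hm : ((m : ℂ) + 1) ≠ 0 := Nat.cast_add_one_ne_zero m
      have h : Int.negSucc (m + 1) = Int.negSucc m - 1 := by omega
      have e1 : ((m : ℂ) + 1) • base par (Int.negSucc m - 1) (gen par x * a) =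
          T par (base par (Int.negSucc m) (gen par x * a)) := by
        rw [T_base, base_T]; congr 1; push_cast [Int.cast_negSucc]; ring
      have z0 : EZ fun k : ℕ => cre par k x * base par (Int.negSucc m + k) a :=
        (base_EZ par _ a).map (fun k v => cre par k x * v) (by simp)
      have z1 : EZ fun k : ℕ => cre par k x * base par (Int.negSucc m - 1 + k) a :=
        (base_EZ par _ a).map (fun k v => cre par k x * v) (by simp)
      have z2 : EZ fun k : ℕ => ((k : ℂ) + 1) • (cre par (k + 1) x * base par (Int.negSucc m + k) a) :=
        (base_EZ par _ a).map (fun k v => ((k : ℂ) + 1) • (cre par (k + 1) x * v)) (by simp)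
      have z3 : EZ fun k : ℕ => (k : ℂ) • (cre par k x * base par (Int.negSucc m - 1 + k) a) :=
        z1.smul _
      have z4 : EZ fun k : ℕ => (-((Int.negSucc m : ℂ) + k)) •
          (cre par k x * base par (Int.negSucc m - 1 + k) a) := z1.smul _
      refine smul_right_injective _ hm ?_
      simp only
      rw [h, e1, ih, map_esum z0, smul_esum _ z1]
      simp only [T_mul, T_cre, T_base, base_T]
      have key : (esum fun k : ℕ => (k : ℂ) • (cre par k x * base par (Int.negSucc m - 1 + k) a)) =
          esum fun k : ℕ => ((k : ℂ) + 1) • (cre par (k + 1) x * base par (Int.negSucc m + k) a) := by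
        rw [esum_succ z3]
        simp only [Nat.cast_zero, zero_smul, zero_add]
        congr 1
        funext k
        push_cast
        rw [show Int.negSucc m - 1 + ((k : ℤ) + 1) = Int.negSucc m + k by ring]
      have e5 : ∀ k : ℕ, cre par k x * -((Int.negSucc m + (k : ℤ) : ℤ) : ℂ) • base par (Int.negSucc m + k - 1) a +
          ((k : ℂ) + 1) • cre par (k + 1) x * base par (Int.negSucc m + k) a =
          (-((Int.negSucc m : ℂ) + k)) • (cre par k x * base par (Int.negSucc m - 1 + k) a) +
          ((k : ℂ) + 1) • (cre par (k + 1) x * base par (Int.negSucc m + k) a) := by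
        intro k
        rw [mul_smul_comm, smul_mul_assoc,
          show Int.negSucc m + (k : ℤ) - 1 = Int.negSucc m - 1 + k by ring]
        push_cast
        rfl
      simp only [e5]
      rw [esum_add z4 z2, ← key, ← esum_add z4 z3]
      congr 1
      funext k
      rw [← add_smul]
      congr 1
      push_cast [Int.cast_negSucc]
      ring

theorem left_EZ1 (n : ℤ) (x : Gen A) (a v : Fock par) :
    EZ fun k : ℕ => cre par k x * nprod par (n + k) a v :=
  (nprod_EZ par n a v).map (fun k v => cre par k x * v) (by simp)

theorem left_EZ2 (n : ℤ) (x : Gen A) (a v : Fock par) :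
    EZ fun l : ℕ => nprod par (n - 1 - l) a (nprod par l (gen par x) v) :=
  (gen_EZ par x v).map (fun l v => nprod par (n - 1 - l) a v) (by simp)

theorem cre_mul_gen_mul (k : ℕ) (x y : Gen A) (w : Fock par) : cre par k x * (gen par y * w) =
    ksign (x.parity par) (y.parity par) • (gen par y * (cre par k x * w)) := by
  rw [cre, smul_mul_assoc, smul_mul_assoc, ← mul_assoc, gen_swap par (x.shift k) y,
    Gen.parity_shift, mul_smul_comm, smul_mul_assoc, mul_assoc, smul_comm]

theorem nprod_gen_mul_sum (n : ℤ) (a : Fock par) (y : Gen A) (b : Fock par) {J : ℕ}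
    (hJ : ∀ j, J ≤ j → rd par y j a = 0) :
    nprod par n a (gen par y * b) = gen par y * nprod par n (tw par (y.parity par) a) b +
      ∑ j ∈ Finset.range J, nprod par (n - j - 1) (rd par y j a) b := by
  rw [nprod_gen_mul, esum_eq_sum (K := J) fun j hj => by rw [hJ j hj]; simp]

theorem nprod_gen_mul_left (n : ℤ) (x : Gen A) (a v : Fock par) :
    nprod par n (gen par x * a) v =
      (esum fun k : ℕ => cre par k x * nprod par (n + k) a v) +
      esum fun l : ℕ => nprod par (n - 1 - l) (tw par (x.parity par) a)
        (nprod par l (gen par x) v) := by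
  induction v using Fock.ind generalizing a n with
  | one =>
    simp only [nprod_one_right]
    rw [base_gen_mul, esum_eq_zero (f := fun l : ℕ => nprod par (n - 1 - l) _ _), add_zero]
    intro l
    rw [base_nonneg par (by simp), map_zero]
  | add u v hu hv =>
    simp only [map_add, hu, hv, mul_add]
    rw [esum_add (left_EZ1 par n x a u) (left_EZ1 par n x a v),
      esum_add (left_EZ2 par n x _ u) (left_EZ2 par n x _ v)]
    abel
  | smul c u hu =>
    simp only [map_smul, hu, mul_smul_comm, smul_add]
    rw [smul_esum _ (left_EZ1 par n x a u), smul_esum _ (left_EZ2 par n x _ u)]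
  | mul y v hv =>
    obtain ⟨J', hJ'⟩ := rd_bound par y a
    obtain ⟨J, hJ, hx⟩ : ∃ J, (∀ j, J ≤ j → rd par y j a = 0) ∧ x.ord + y.ord ≤ J :=
      ⟨max J' (x.ord + y.ord), fun j hj => hJ' j (le_of_max_le_left hj), le_max_right _ _⟩
    have hk : ∀ j, J ≤ j → kap par x y j = 0 := fun j hj => kap_bound par x y j (hx.trans hj)
    rw [nprod_gen_mul_sum par n (gen par x * a) y v (J := J)
      (fun j hj => by rw [rd_gen_mul, hJ j hj, hk j hj]; simp)]
    have e1 : ∀ k : ℕ, cre par k x * nprod par (n + k) a (gen par y * v) =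
        ksign (x.parity par) (y.parity par) • (gen par y *
          (cre par k x * nprod par (n + k) (tw par (y.parity par) a) v)) +
        ∑ j ∈ Finset.range J, cre par k x * nprod par (n - j - 1 + k) (rd par y j a) v := by
      intro k
      rw [nprod_gen_mul_sum par (n + k) a y v hJ, mul_add, cre_mul_gen_mul, Finset.mul_sum]
      congr 1
      refine Finset.sum_congr rfl fun j _ => ?_
      rw [show n + k - j - 1 = n - j - 1 + (k : ℤ) by ring]
    have e2 : ∀ l : ℕ, nprod par (n - 1 - l) (tw par (x.parity par) a)
          (nprod par l (gen par x) (gen par y * v)) =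
        ksign (x.parity par) (y.parity par) • (gen par y * nprod par (n - 1 - l)
          (tw par (x.parity par) (tw par (y.parity par) a)) (nprod par l (gen par x) v) +
        ∑ j ∈ Finset.range J, nprod par (n - j - 1 - 1 - l) (rd par y j (tw par (x.parity par) a))
          (nprod par l (gen par x) v)) +
        kap par x y l • nprod par (n - 1 - l) (tw par (x.parity par) a) v := by
      intro l
      rw [nprod_gen_gen_mul, map_add, map_smul, map_smul, nprod_gen_mul_sum par (n - 1 - l) _ y _
        (J := J) (fun j hj => by rw [rd_tw, hJ j hj]; simp), tw_comm]
      congr 3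
      refine Finset.sum_congr rfl fun j _ => ?_
      rw [show n - 1 - l - j - 1 = n - j - 1 - 1 - (l : ℤ) by ring]
    have zz : ∀ a, EZ fun k : ℕ => gen par y * (cre par k x * nprod par (n + k) a v) := fun a =>
      (left_EZ1 par n x a v).map (fun _ w => gen par y * w) (by simp)
    have zy : ∀ a, EZ fun l : ℕ => gen par y * nprod par (n - 1 - l) a (nprod par l (gen par x) v) :=
      fun a => (left_EZ2 par n x a v).map (fun _ w => gen par y * w) (by simp)
    have zk : EZ fun l : ℕ => kap par x y l • nprod par (n - 1 - l) (tw par (x.parity par) a) v :=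
      ⟨J, fun l hl => by simp only [hk l hl, zero_smul]⟩
    have zs1 : EZ fun k : ℕ => ∑ j ∈ Finset.range J,
        cre par k x * nprod par (n - j - 1 + k) (rd par y j a) v :=
      EZ.sum _ fun j _ => left_EZ1 par _ x _ v
    have zs2 : EZ fun l : ℕ => ∑ j ∈ Finset.range J, nprod par (n - j - 1 - 1 - l)
        (rd par y j (tw par (x.parity par) a)) (nprod par l (gen par x) v) :=
      EZ.sum _ fun j _ => left_EZ2 par _ x _ v
    have my : ∀ f : ℕ → Fock par, EZ f →
        (esum fun k => gen par y * f k) = gen par y * esum f :=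
      fun f hf => (map_esum hf (LinearMap.mulLeft ℂ (gen par y))).symm
    simp only [e1, e2]
    rw [esum_add ((zz _).smul _) zs1, esum_add (((zy _).add zs2).smul _) zk,
      ← smul_esum _ (zz _), ← smul_esum _ ((zy _).add zs2), esum_add (zy _) zs2,
      my _ (left_EZ1 par n x _ v), my _ (left_EZ2 par n x _ v),
      esum_sum _ (fun j _ => left_EZ1 par _ x _ v), esum_sum _ (fun j _ => left_EZ2 par _ x _ v),
      esum_eq_sum (K := J) (f := fun l : ℕ => kap par x y l • _) (fun l hl => by simp only [hk l hl, zero_smul])]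
    simp only [map_mul, tw_gen, smul_mul_assoc, map_smul, LinearMap.smul_apply, rd_gen_mul, map_add,
      LinearMap.add_apply, hv, Finset.sum_add_distrib]
    have e3 : ∀ j : ℕ, kap par x y j • nprod par (n - j - 1) (tw par (y.parity par) a) v =
        kap par x y j • nprod par (n - 1 - j) (tw par (x.parity par) a) v := by
      intro j
      by_cases h : kap par x y j = 0
      · simp [h]
      · rw [kap_parity par h, sub_right_comm]
    simp only [e3, rd_tw, map_smul, LinearMap.smul_apply]
    have e4 : ∀ j : ℕ, (esum fun l : ℕ => ksign (x.parity par) (y.parity par) •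
        nprod par (n - j - 1 - 1 - l) (tw par (x.parity par) (rd par y j a))
          (nprod par l (gen par x) v)) = ksign (x.parity par) (y.parity par) • esum fun l : ℕ =>
        nprod par (n - j - 1 - 1 - l) (tw par (x.parity par) (rd par y j a))
          (nprod par l (gen par x) v) := fun j => (smul_esum _ (left_EZ2 par _ x _ v) _).symm
    simp only [e4, ← Finset.smul_sum, smul_add, smul_smul, ksign_mul_self, one_smul, mul_add,
      mul_smul_comm]
    rw [ksign_comm (y.parity par) (x.parity par)]
    abel

/-! ## Commutators -/

theorem rd_tw_self (x : Gen A) (j : ℕ) (b : Fock par) :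
    rd par x j (tw par (x.parity par) b) = -(-1 : ℂ) ^ j • nprod par j (gen par x) b := by
  induction b using Fock.ind with
  | one => rw [map_one, rd_one, nprod_gen_one par (by simp), smul_zero]
  | add u v hu hv => simp only [map_add, hu, hv, smul_add]
  | smul c u hu => simp only [map_smul, hu, smul_comm c]
  | mul y b hb =>
    rw [map_mul, tw_gen, smul_mul_assoc, map_smul, rd_gen_mul, hb, tw_tw_self, nprod_gen_gen_mul,
      kap_skew par x y, mul_smul_comm]
    change _ = -(-1 : ℂ) ^ j • (_ + kap par x y j • b)
    match_scalars
    · ring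
    · linear_combination (-(-1 : ℂ) ^ j * kap par x y j) * ksign_mul_self (x.parity par) (y.parity par)

theorem kap_shift_lt (y x : Gen A) {j k : ℕ} (h : j < k) : kap par y (x.shift k) j = 0 := by
  apply kap_neg; simp only [Gen.shift]; omega

theorem kap_shift_add (y x : Gen A) (j k : ℕ) : kap par y (x.shift k) (j + k) =
    k.factorial * (j + k).choose k * kap par y x j := by
  by_cases h : y.up ≠ x.up ∧ y.idx = x.idx ∧ y.ord + x.ord = 2 * j + 1
  · rw [kap_pos par h, kap_pos par (x := y) (y := x.shift k)
      ⟨h.1, h.2.1, by simp only [Gen.shift]; omega⟩]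
    have := Nat.add_choose_mul_factorial_mul_factorial j k
    rw [← this]
    push_cast
    ring
  · rw [kap_neg par h, kap_neg par (x := y) (y := x.shift k)]
    · simp
    · rintro ⟨h1, h2, h3⟩
      simp only [Gen.shift] at h3
      exact h ⟨h1, h2, by omega⟩

theorem rd_shift_lt (x : Gen A) {j k : ℕ} (h : j < k) (b : Fock par) :
    rd par (x.shift k) j b = 0 := by
  induction b using Fock.ind with
  | one => simp
  | add u v hu hv => simp [hu, hv]
  | smul c u hu => simp [hu]
  | mul y b hb => rw [rd_gen_mul, hb, kap_shift_lt par y x h]; simp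

theorem rd_shift_add (x : Gen A) (j k : ℕ) (b : Fock par) : rd par (x.shift k) (j + k) b =
    ((k.factorial : ℂ) * (j + k).choose k) • rd par x j b := by
  induction b using Fock.ind with
  | one => simp
  | add u v hu hv => simp [hu, hv]
  | smul c u hu => simp [hu, smul_comm c]
  | mul y b hb =>
    rw [rd_gen_mul, hb, kap_shift_add par y x, rd_gen_mul, Gen.parity_shift, mul_smul_comm]
    module

theorem esum_shift {V : Type*} [AddCommGroup V] [Module ℂ V] {f : ℕ → V} (hf : EZ f) (k : ℕ) (h : ∀ j < k, f j = 0) :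
    esum f = esum fun i => f (i + k) := by
  induction k with
  | zero => rfl
  | succ k ih =>
    have z : EZ fun i => f (i + k) := by
      obtain ⟨K, hK⟩ := hf
      exact ⟨K, fun i hi => hK _ (by omega)⟩
    rw [ih fun j hj => h j (by omega), esum_succ z, zero_add, h k (by omega), zero_add]
    congr 1
    funext i
    rw [add_right_comm, add_assoc]

theorem comm_neg (k : ℕ) (x : Gen A) (n : ℤ) (b v : Fock par) {I : ℕ}
    (hI : ∀ i : ℕ, I ≤ i → nprod par i (gen par x) b = 0) :
    cre par k x * nprod par n b v = nprod par n (tw par (x.parity par) b) (cre par k x * v) +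
      ∑ i ∈ Finset.range I, ((-1 : ℂ) ^ i * (i + k).choose k) •
        nprod par (n - k - 1 - i) (nprod par i (gen par x) b) v := by
  rw [cre, smul_mul_assoc, smul_mul_assoc, map_smul, nprod_gen_mul, Gen.parity_shift, tw_tw_self,
    smul_add, esum_shift (contrP_EZ par _ _ _ _) k
      (fun j hj => by rw [rd_shift_lt par x hj]; simp), smul_esum _ ?_, esum_eq_sum (K := I),
    add_assoc, ← Finset.sum_add_distrib, left_eq_add]
  · refine Finset.sum_eq_zero fun i _ => ?_
    rw [rd_shift_add, rd_tw_self]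
    have := Nat.cast_ne_zero (R := ℂ).2 k.factorial_ne_zero
    simp only [map_smul, LinearMap.smul_apply, smul_smul]
    rw [show n - ((i + k : ℕ) : ℤ) - 1 = n - k - 1 - i by push_cast; ring, ← add_smul]
    convert zero_smul ℂ _
    field_simp
    ring
  · intro i hi
    rw [rd_shift_add, rd_tw_self, hI i hi]; simp
  · exact ⟨I, fun i hi => by simp only [rd_shift_add, rd_tw_self, hI i hi, smul_zero, map_zero, LinearMap.zero_apply]⟩

theorem T_nprod (n : ℤ) (a b : Fock par) :
    T par (nprod par n a b) = nprod par n a (T par b) + nprod par n (T par a) b := by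
  simp only [T, LinearMap.comp_apply, nprod_D, map_add, D_tw, tw_tw_self]
  simp

theorem comm_base (j : ℕ) (x : Gen A) (n : ℤ) (b : Fock par) :
    nprod par j (gen par x) (base par n b) = ∑ i ∈ Finset.range (j + 1),
      (j.choose i : ℂ) • base par (n + j - i) (nprod par i (gen par x) b) := by
  cases n with
  | ofNat n =>
    rw [base_nonneg par (by simp), map_zero, Finset.sum_eq_zero]
    intro i hi
    rw [base_nonneg par, smul_zero]
    have := Finset.mem_range.1 hi
    simp only [Int.ofNat_eq_natCast]; omega
  | negSucc m =>
    induction m generalizing j with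
    | zero =>
      change nprod par j (gen par x) (base par (-1) b) = ∑ i ∈ Finset.range (j + 1),
        (j.choose i : ℂ) • base par (-1 + j - i) (nprod par i (gen par x) b)
      rw [Finset.sum_range_succ, Finset.sum_eq_zero, base_neg_one]
      · simp [base_neg_one]
      · intro i hi
        have := Finset.mem_range.1 hi
        rw [base_nonneg par (by omega), smul_zero]
    | succ m ih =>
      have hm : ((m : ℂ) + 1) ≠ 0 := Nat.cast_add_one_ne_zero m
      have h : Int.negSucc (m + 1) = Int.negSucc m - 1 := by omega
      have e1 : ((m : ℂ) + 1) • base par (Int.negSucc m - 1) b =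
          T par (base par (Int.negSucc m) b) := by
        rw [T_base, base_T]; congr 1; push_cast [Int.cast_negSucc]; ring
      refine smul_right_injective _ hm ?_
      simp only
      have e2 := T_nprod par j (gen par x) (base par (Int.negSucc m) b)
      rw [nprod_T] at e2
      rw [h, ← map_smul, e1, ← sub_eq_of_eq_add e2, ih]
      have e3 : ∀ M : ℤ, ∀ a, T par (base par M a) = -(M : ℂ) • base par (M - 1) a := by
        intro M a; rw [T_base, base_T]
      cases j with
      | zero =>
        simp [e3, Int.cast_negSucc]
      | succ j =>
        have e4 : ∑ i ∈ Finset.range (j + 1), (j.choose i : ℂ) • base par (Int.negSucc m + j - i)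
            (nprod par i (gen par x) b) = ∑ i ∈ Finset.range (j + 1 + 1),
            (j.choose i : ℂ) • base par (Int.negSucc m + j - i) (nprod par i (gen par x) b) := by
          rw [Finset.sum_range_succ _ (j + 1), Nat.choose_succ_self]; simp
        rw [show ((j + 1 : ℕ) : ℤ) - 1 = j by push_cast; ring, ih, e4, map_sum, Finset.smul_sum,
          Finset.smul_sum, ← Finset.sum_sub_distrib]
        refine Finset.sum_congr rfl fun i hi => ?_
        have hi' : i ≤ j + 1 := by simpa [Nat.lt_succ_iff] using hi
        rw [map_smul, e3, show Int.negSucc m + ((j + 1 : ℕ) : ℤ) - i - 1 = Int.negSucc m + j - i by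
          push_cast; ring, show Int.negSucc m - 1 + ((j + 1 : ℕ) : ℤ) - i = Int.negSucc m + j - i by
          push_cast; ring, smul_smul, smul_smul, smul_smul, ← sub_smul]
        congr 1
        have key : ((j.choose i * (j + 1) : ℕ) : ℂ) = ((j + 1).choose i * (j + 1 - i) : ℕ) :=
          congrArg _ (Nat.choose_mul_succ_eq j i)
        push_cast [Nat.cast_sub hi', Int.cast_negSucc] at key ⊢
        linear_combination key


theorem rd_nprod (y x : Gen A) (i j : ℕ) (b : Fock par) :
    rd par y i (nprod par j (gen par x) b) = nprod par j (gen par x) (rd par y i b) := by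
  induction b using Fock.ind with
  | one => rw [nprod_gen_one par (by simp)]; simp
  | add u v hu hv => simp only [map_add, hu, hv]
  | smul c u hu => simp only [map_smul, hu]
  | mul z b hb =>
    have ez : ∀ c : Fock par, nprod par j (gen par x) (gen par z * c) =
      ksign (x.parity par) (z.parity par) • (gen par z * nprod par j (gen par x) c) +
        kap par x z j • c := fun c => nprod_gen_gen_mul par j x z c
    rw [ez, map_add, map_smul, map_smul, rd_gen_mul, rd_gen_mul, hb, map_add, ez, map_smul,
      nprod_tw, tw_gen, map_smul, LinearMap.smul_apply]
    have e : kap par z y i * ksign (x.parity par) (z.parity par) * ksign (y.parity par) (x.parity par) =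
        kap par z y i := by
      by_cases h : kap par z y i = 0
      · simp [h]
      · rw [kap_parity par h, mul_assoc, ksign_comm, ksign_mul_self, mul_one]
    match_scalars
    · ring
    · linear_combination e
    · ring

theorem comm_pos (j : ℕ) (x : Gen A) (n : ℤ) (b v : Fock par) :
    nprod par j (gen par x) (nprod par n b v) =
      nprod par n (tw par (x.parity par) b) (nprod par j (gen par x) v) +
      ∑ i ∈ Finset.range (j + 1),
        (j.choose i : ℂ) • nprod par (n + j - i) (nprod par i (gen par x) b) v := by
  induction v using Fock.ind generalizing n b with
  | one =>
    rw [nprod_one_right, comm_base, nprod_gen_one par (by simp), map_zero, zero_add]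
    simp only [nprod_one_right]
  | add u v hu hv => simp only [map_add, hu, hv, smul_add, Finset.sum_add_distrib]; abel
  | smul c u hu =>
    simp only [map_smul, hu, smul_add, Finset.smul_sum]
    congr 1
    exact Finset.sum_congr rfl fun i _ => smul_comm _ _ _
  | mul z v hv =>
    have ez : ∀ c : Fock par, nprod par j (gen par x) (gen par z * c) =
      ksign (x.parity par) (z.parity par) • (gen par z * nprod par j (gen par x) c) +
        kap par x z j • c := fun c => nprod_gen_gen_mul par j x z c
    obtain ⟨J, hJ⟩ := rd_bound par z b
    have et : ∀ i : ℕ, tw par (z.parity par) (nprod par i (gen par x) b) =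
        ksign (x.parity par) (z.parity par) • nprod par i (gen par x) (tw par (z.parity par) b) := by
      intro i
      rw [nprod_tw, tw_gen, map_smul, LinearMap.smul_apply, ksign_comm]
    have e1 : ∀ i : ℕ, nprod par (n + j - i) (nprod par i (gen par x) b) (gen par z * v) =
        ksign (x.parity par) (z.parity par) • (gen par z *
          nprod par (n + j - i) (nprod par i (gen par x) (tw par (z.parity par) b)) v) +
        ∑ r ∈ Finset.range J,
          nprod par (n - r - 1 + j - i) (nprod par i (gen par x) (rd par z r b)) v := by
      intro i
      rw [nprod_gen_mul_sum par _ _ z v (J := J) fun r hr => by rw [rd_nprod, hJ r hr, map_zero],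
        et, map_smul, LinearMap.smul_apply, mul_smul_comm]
      congr 1
      refine Finset.sum_congr rfl fun r _ => ?_
      rw [rd_nprod, show n + j - i - r - 1 = n - r - 1 + (j : ℤ) - i by ring]
    rw [nprod_gen_mul_sum par n b z v hJ, map_add, map_sum, ez, hv, ez, map_add, map_smul, map_smul,
      nprod_gen_mul_sum par n _ z _ (J := J) fun r hr => by rw [rd_tw, hJ r hr]; simp]
    simp only [hv, e1, rd_tw, map_smul, LinearMap.smul_apply, smul_add, Finset.sum_add_distrib,
      mul_add, Finset.mul_sum, mul_smul_comm, Finset.smul_sum, smul_smul]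
    rw [Finset.sum_comm (s := Finset.range (j + 1))]
    have e2 : kap par x z j • nprod par n (tw par (z.parity par) b) v =
        kap par x z j • nprod par n (tw par (x.parity par) b) v := by
      by_cases h : kap par x z j = 0
      · simp [h]
      · rw [kap_parity par h]
    rw [e2, tw_comm par (z.parity par)]
    simp only [mul_comm _ (ksign (x.parity par) (z.parity par)), ksign_mul_self, one_smul]
    abel

theorem comm_pos' (j : ℕ) (x : Gen A) (n : ℤ) (b v : Fock par) {I : ℕ}
    (hI : ∀ i : ℕ, I ≤ i → nprod par i (gen par x) b = 0) :
    nprod par j (gen par x) (nprod par n b v) =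
      nprod par n (tw par (x.parity par) b) (nprod par j (gen par x) v) +
      ∑ i ∈ Finset.range I,
        (j.choose i : ℂ) • nprod par (n + j - i) (nprod par i (gen par x) b) v := by
  rw [comm_pos]
  congr 1
  rw [← esum_eq_sum (f := fun i : ℕ => (j.choose i : ℂ) • nprod par (n + j - i) (nprod par i (gen par x) b) v),
    ← esum_eq_sum (f := fun i : ℕ => (j.choose i : ℂ) • nprod par (n + j - i) (nprod par i (gen par x) b) v)]
  · intro i hi; rw [hI i hi]; simp
  · intro i hi; rw [Nat.choose_eq_zero_of_lt (by omega)]; simp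

section Shift
variable {V : Type*} [AddCommGroup V] [Module ℂ V]

/-- The shift of a doubly indexed family. -/
def shf (i j : ℤ) : Module.End ℂ (ℤ → ℤ → V) where
  toFun f m n := f (m + i) (n + j)
  map_add' _ _ := rfl
  map_smul' _ _ := rfl

/-- Multiplication by `z - w`, in terms of the coefficients. -/
def dl : Module.End ℂ (ℤ → ℤ → V) := -shf 0 1 + shf 1 0

theorem shf_mul (i j k l : ℤ) : (shf i j * shf k l : Module.End ℂ (ℤ → ℤ → V)) =
    shf (i + k) (j + l) := by
  ext f m n
  simp [shf, add_assoc, add_comm, add_left_comm]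

theorem shf_pow (i j : ℤ) (N : ℕ) : (shf i j ^ N : Module.End ℂ (ℤ → ℤ → V)) =
    shf (N * i) (N * j) := by
  induction N with
  | zero => ext f m n; simp [shf]
  | succ N ih => rw [pow_succ, ih, shf_mul]; congr 1 <;> push_cast <;> ring

theorem shf_comm (i j k l : ℤ) : Commute (shf i j : Module.End ℂ (ℤ → ℤ → V)) (shf k l) := by
  change _ * _ = _ * _
  rw [shf_mul, shf_mul, add_comm i, add_comm j]

theorem dl_shf (i j : ℤ) : Commute (dl : Module.End ℂ (ℤ → ℤ → V)) (shf i j) :=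
  Commute.add_left (Commute.neg_left (shf_comm (V := V) 0 1 i j)) (shf_comm (V := V) 1 0 i j)

theorem dl_apply (f : ℤ → ℤ → V) (m n : ℤ) : dl f m n = f (m + 1) n - f m (n + 1) := by
  simp [dl, shf]; abel

theorem dl_pow_apply (N : ℕ) (f : ℤ → ℤ → V) (m n : ℤ) : (dl ^ N) f m n =
    ∑ i ∈ Finset.range (N + 1), ((-1 : ℂ) ^ i * N.choose i) • f (m + N - i) (n + i) := by
  have hc : Commute (-shf 0 1 : Module.End ℂ (ℤ → ℤ → V)) (shf 1 0) :=
    Commute.neg_left (shf_comm (V := V) 0 1 1 0)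
  rw [dl, hc.add_pow, LinearMap.sum_apply, Finset.sum_apply, Finset.sum_apply]
  refine Finset.sum_congr rfl fun i hi => ?_
  have hi' : i ≤ N := by simpa [Nat.lt_succ_iff] using hi
  have e : (-shf 0 1 : Module.End ℂ (ℤ → ℤ → V)) ^ i * shf 1 0 ^ (N - i) * (N.choose i : Module.End ℂ (ℤ → ℤ → V)) =
      ((-1 : ℂ) ^ i * N.choose i) • shf ((N - i : ℕ) : ℤ) i := by
    rw [neg_pow (shf 0 1 : Module.End ℂ (ℤ → ℤ → V)) i, shf_pow, shf_pow, mul_assoc ((-1) ^ i), shf_mul, ← smul_smul]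
    have h1 : ((-1) ^ i : Module.End ℂ (ℤ → ℤ → V)) = ((-1 : ℂ) ^ i) • 1 := by
      rw [← Algebra.algebraMap_eq_smul_one]; simp
    have h2 : (N.choose i : Module.End ℂ (ℤ → ℤ → V)) = (N.choose i : ℂ) • 1 := by
      rw [← Algebra.algebraMap_eq_smul_one]; simp
    rw [h1, h2, smul_mul_assoc, one_mul, smul_mul_assoc, mul_smul_comm, mul_one]
    simp
  rw [e]
  change ((-1 : ℂ) ^ i * N.choose i) • f (m + ((N - i : ℕ) : ℤ)) (n + i) = _
  rw [Nat.cast_sub hi', add_sub_assoc]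

theorem dl_pow_mono {N M : ℕ} (h : N ≤ M) {f : ℤ → ℤ → V} (hf : (dl ^ N) f = 0) :
    (dl ^ M) f = 0 := by
  obtain ⟨k, rfl⟩ := Nat.exists_eq_add_of_le h
  rw [add_comm, pow_add, Module.End.mul_apply, hf, map_zero]

theorem esum_dl_pow (N : ℕ) (g : ℤ → ℤ → V) (hg : ∀ m n, EZ fun k : ℕ => g (m + k) n)
    (L : ℕ → V →ₗ[ℂ] V) (h0 : (dl ^ N) g = 0) :
    (dl ^ N) (fun m n => esum fun k : ℕ => L k (g (m + k) n)) = 0 := by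
  induction N generalizing g with
  | zero =>
    rw [pow_zero, Module.End.one_apply] at h0 ⊢
    subst h0
    funext m n
    simp [esum_zero]
  | succ N ih =>
    rw [pow_succ, Module.End.mul_apply] at h0 ⊢
    have hd : ∀ m n, EZ fun k : ℕ => dl g (m + k) n := fun m n => by
      have h1 := hg (m + 1) n
      have h2 := hg m (n + 1)
      simp only [dl_apply]
      refine EZ.sub ?_ h2
      simpa only [add_right_comm] using h1
    rw [← ih (dl g) hd h0]
    congr 1
    funext m n
    rw [dl_apply, ← esum_sub ((hg (m + 1) n).map (fun k v => L k v) (by simp))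
      ((hg m (n + 1)).map (fun k v => L k v) (by simp))]
    congr 1
    funext k
    rw [dl_apply, map_sub, add_right_comm]

end Shift


/-- The coefficients of the supercommutator of the fields of `a` and `b`, applied to `v`, where `b`
has parity `q`. -/
noncomputable def Com (q : ZMod 2) (a b v : Fock par) (m n : ℤ) : Fock par :=
  nprod par m a (nprod par n b v) - nprod par n b (nprod par m (tw par q a) v)

/-- An auxiliary sum in the commutator of a product with `b`. -/
noncomputable def Hs (a y v : Fock par) (i : ℕ) (m n : ℤ) : Fock par :=
  esum fun l : ℕ => (l.choose i : ℂ) • nprod par (m - 1 - l) a (nprod par (n - i + l) y v)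

/-- An auxiliary sum in the commutator of a product with `b`. -/
noncomputable def Ks (a y v : Fock par) (i : ℕ) (m n : ℤ) : Fock par :=
  esum fun k : ℕ => ((-1 : ℂ) ^ i * (i + k).choose k) •
    nprod par (n - k - 1 - i) y (nprod par (m + k) a v)

theorem Hs_EZ (a y v : Fock par) (m n : ℤ) :
    EZ fun l : ℕ => nprod par (m - l) a (nprod par (n + l) y v) :=
  (nprod_EZ par n y v).map (fun l w => nprod par (m - l) a w) (by simp)

theorem Ks_EZ (a y v : Fock par) (m n : ℤ) :
    EZ fun k : ℕ => nprod par (n - k) y (nprod par (m + k) a v) :=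
  (nprod_EZ par m a v).map (fun l w => nprod par (n - l) y w) (by simp)

theorem dl_Hs_zero (a y v : Fock par) : dl (Hs par a y v 0) =
    fun m n => nprod par m a (nprod par n y v) := by
  funext m n
  have z := Hs_EZ par a y v m n
  rw [dl_apply, Hs, Hs]
  have e : (fun l : ℕ => (l.choose 0 : ℂ) • nprod par (m + 1 - 1 - l) a (nprod par (n - (0 : ℕ) + l) y v)) =
      fun l : ℕ => nprod par (m - l) a (nprod par (n + l) y v) := by
    funext l; simp
  rw [e, esum_succ z, sub_eq_iff_eq_add]
  congr 1
  · simp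
  · congr 1
    funext l
    rw [show m - ((l + 1 : ℕ) : ℤ) = m - 1 - l by push_cast; ring,
      show n + ((l + 1 : ℕ) : ℤ) = n + 1 - (0 : ℕ) + l by push_cast; ring]
    simp

theorem dl_Hs_succ (a y v : Fock par) (i : ℕ) : dl (Hs par a y v (i + 1)) = Hs par a y v i := by
  funext m n
  rw [dl_apply, Hs, Hs, Hs]
  have z1 : EZ fun l : ℕ => (l.choose (i + 1) : ℂ) • nprod par (m + 1 - 1 - l) a
      (nprod par (n - (i + 1 : ℕ) + l) y v) := (Hs_EZ par a y v _ _).smul _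
  have z2 : EZ fun l : ℕ => (l.choose (i + 1) : ℂ) • nprod par (m - 1 - l) a
      (nprod par (n + 1 - (i + 1 : ℕ) + l) y v) := (Hs_EZ par a y v _ _).smul _
  rw [esum_succ z1, Nat.choose_zero_succ, Nat.cast_zero, zero_smul, zero_add, ← esum_sub z1.succ z2]
  congr 1
  funext l
  rw [show m + 1 - 1 - ((l + 1 : ℕ) : ℤ) = m - 1 - l by push_cast; ring,
    show n - ((i + 1 : ℕ) : ℤ) + ((l + 1 : ℕ) : ℤ) = n - i + l by push_cast; ring,
    show n + 1 - ((i + 1 : ℕ) : ℤ) + l = n - i + l by push_cast; ring, ← sub_smul,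
    Nat.choose_succ_succ]
  congr 1
  push_cast; ring

theorem Ks_EZ' (a y v : Fock par) (m n c : ℤ) (d : ℕ → ℂ) :
    EZ fun k : ℕ => d k • nprod par (n - k - 1 - c) y (nprod par (m + k) a v) :=
  (nprod_EZ par m a v).map (fun l w => d l • nprod par (n - l - 1 - c) y w) (by simp)

theorem dl_Ks_zero (a y v : Fock par) : dl (Ks par a y v 0) =
    fun m n => -nprod par n y (nprod par m a v) := by
  funext m n
  have z := Ks_EZ par a y v m n
  have e : (fun k : ℕ => ((-1 : ℂ) ^ 0 * (0 + k).choose k) •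
      nprod par (n + 1 - k - 1 - (0 : ℕ)) y (nprod par (m + k) a v)) =
      fun l : ℕ => nprod par (n - l) y (nprod par (m + l) a v) := by
    funext l; rw [show n + 1 - l - 1 - ((0 : ℕ) : ℤ) = n - l by push_cast; ring]; simp
  have e' : (fun k : ℕ => ((-1 : ℂ) ^ 0 * (0 + k).choose k) •
      nprod par (n - k - 1 - (0 : ℕ)) y (nprod par (m + 1 + k) a v)) =
      fun l : ℕ => nprod par (n - (l + 1 : ℕ)) y (nprod par (m + (l + 1 : ℕ)) a v) := by
    funext l
    rw [show n - l - 1 - ((0 : ℕ) : ℤ) = n - (l + 1 : ℕ) by push_cast; ring,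
      show m + ((l + 1 : ℕ) : ℤ) = m + 1 + l by push_cast; ring]; simp
  rw [dl_apply, Ks, Ks, e, e', esum_succ z]
  simp

theorem dl_Ks_succ (a y v : Fock par) (i : ℕ) : dl (Ks par a y v (i + 1)) = Ks par a y v i := by
  funext m n
  rw [dl_apply, Ks, Ks, Ks]
  rw [esum_succ (Ks_EZ' par a y v m (n + 1) (i + 1 : ℕ) _), esum_succ (Ks_EZ' par a y v m n i _),
    sub_add_eq_sub_sub, sub_right_comm,
    ← esum_sub (Ks_EZ' par a y v (m + 1) n (i + 1 : ℕ)
        fun k => (-1 : ℂ) ^ (i + 1) * (i + 1 + k).choose k)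
      (Ks_EZ' par a y v m (n + 1) (i + 1 : ℕ)
        fun k => (-1 : ℂ) ^ (i + 1) * (i + 1 + k).choose k).succ,
    sub_eq_iff_eq_add, add_right_comm]
  have e1 : n + 1 - ((0 : ℕ) : ℤ) - 1 - ((i + 1 : ℕ) : ℤ) = n - ((0 : ℕ) : ℤ) - 1 - i := by
    push_cast; ring
  have e2 : ((-1 : ℂ) ^ i * (i + 0).choose 0) • nprod par (n - ((0 : ℕ) : ℤ) - 1 - i) y
      (nprod par (m + ((0 : ℕ) : ℤ)) a v) + ((-1 : ℂ) ^ (i + 1) * (i + 1 + 0).choose 0) •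
      nprod par (n + 1 - ((0 : ℕ) : ℤ) - 1 - ((i + 1 : ℕ) : ℤ)) y
      (nprod par (m + ((0 : ℕ) : ℤ)) a v) = 0 := by
    rw [e1, ← add_smul, pow_succ]
    simp
  rw [e2, zero_add]
  congr 1
  funext k
  rw [show n - (k : ℤ) - 1 - ((i + 1 : ℕ) : ℤ) = n - ((k + 1 : ℕ) : ℤ) - 1 - i by push_cast; ring,
    show n + 1 - ((k + 1 : ℕ) : ℤ) - 1 - ((i + 1 : ℕ) : ℤ) = n - ((k + 1 : ℕ) : ℤ) - 1 - i by
      push_cast; ring,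
    show m + ((k + 1 : ℕ) : ℤ) = m + 1 + k by push_cast; ring, ← sub_smul]
  congr 1
  have h := Nat.choose_succ_succ (i + 1 + k) k
  rw [show i + 1 + (k + 1) = i + 1 + k + 1 by ring, show i + (k + 1) = i + 1 + k by ring, h]
  push_cast; ring

theorem Com_tw {q : ZMod 2} (r : ZMod 2) (a : Fock par) {b : Fock par} (hb : b ∈ grade par q)
    (v : Fock par) (m n : ℤ) : Com par q (tw par r a) b v m n =
    ksign r q • tw par r (Com par q a b (tw par r v) m n) := by
  simp only [Com, map_sub, nprod_tw, tw_tw_self, tw_of_mem par hb r, map_smul, LinearMap.smul_apply,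
    smul_sub, smul_smul, ksign_mul_self, one_smul]
  rw [tw_comm]

theorem Com_gen_mul {q : ZMod 2} (x : Gen A) (a : Fock par) {b : Fock par} (hb : b ∈ grade par q)
    (v : Fock par) {I L : ℕ} (hI : ∀ i : ℕ, I ≤ i → nprod par i (gen par x) b = 0)
    (hL : ∀ i : ℕ, L ≤ i → nprod par i (gen par x) v = 0) :
    Com par q (gen par x * a) b v =
      (fun m n => esum fun k : ℕ => LinearMap.mulLeft ℂ (cre par k x) (Com par q a b v (m + k) n)) +
      ksign q (x.parity par) • ∑ l ∈ Finset.range L, shf (-1 - l) 0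
        (Com par q (tw par (x.parity par) a) b (nprod par l (gen par x) v)) +
      ∑ i ∈ Finset.range I,
        (Hs par (tw par (x.parity par) a) (nprod par i (gen par x) b) v i +
          Ks par (tw par q a) (nprod par i (gen par x) b) v i) := by
  funext m n
  have e0 : ∀ (f : ℕ → ℤ → ℤ → Fock par) (s : Finset ℕ), (∑ i ∈ s, f i) m n = ∑ i ∈ s, f i m n := by
    intro f s
    rw [Finset.sum_apply, Finset.sum_apply]
  simp only [Pi.add_apply, Pi.smul_apply, e0, LinearMap.mulLeft_apply]
  have e1 : nprod par m (gen par x * a) (nprod par n b v) =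
      (esum fun k : ℕ => cre par k x * nprod par (m + k) a (nprod par n b v)) +
      (ksign q (x.parity par) • ∑ l ∈ Finset.range L, nprod par (m - 1 - l)
          (tw par (x.parity par) a) (nprod par n b (nprod par l (gen par x) v)) +
        ∑ i ∈ Finset.range I, Hs par (tw par (x.parity par) a)
          (nprod par i (gen par x) b) v i m n) := by
    rw [nprod_gen_mul_left]
    congr 1
    have e2 : ∀ l : ℕ, nprod par (m - 1 - l) (tw par (x.parity par) a)
        (nprod par l (gen par x) (nprod par n b v)) =
        ksign q (x.parity par) • nprod par (m - 1 - l)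
          (tw par (x.parity par) a) (nprod par n b (nprod par l (gen par x) v)) +
        ∑ i ∈ Finset.range I, (l.choose i : ℂ) • nprod par (m - 1 - l)
          (tw par (x.parity par) a) (nprod par (n - i + l) (nprod par i (gen par x) b) v) := by
      intro l
      rw [comm_pos' par l x n b v hI, tw_of_mem par hb, map_add, map_smul, LinearMap.smul_apply,
        map_smul, ksign_comm, map_sum]
      congr 1
      refine Finset.sum_congr rfl fun i _ => ?_
      rw [map_smul, show n + l - (i : ℤ) = n - i + l by ring]
    have z1 : EZ fun l : ℕ => nprod par (m - 1 - l) (tw par (x.parity par) a)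
        (nprod par n b (nprod par l (gen par x) v)) :=
      (gen_EZ par x v).map (fun l w => nprod par (m - 1 - l) (tw par (x.parity par) a)
        (nprod par n b w)) (by simp)
    have z2 : ∀ i : ℕ, EZ fun l : ℕ => (l.choose i : ℂ) • nprod par (m - 1 - l)
          (tw par (x.parity par) a) (nprod par (n - i + l) (nprod par i (gen par x) b) v) :=
      fun i => (Hs_EZ par _ _ v _ _).smul _
    simp only [e2]
    rw [esum_add (z1.smul _) (EZ.sum _ fun i _ => z2 i), ← smul_esum _ z1,
      esum_sum _ fun i _ => z2 i, esum_eq_sum (K := L) fun l hl => by simp only [hL l hl, map_zero]]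
    rfl
  have e3 : nprod par n b (nprod par m (tw par q (gen par x * a)) v) =
      (esum fun k : ℕ => cre par k x * nprod par n b (nprod par (m + k) (tw par q a) v)) +
      ksign q (x.parity par) • ∑ l ∈ Finset.range L, nprod par n b (nprod par (m - 1 - l)
          (tw par q (tw par (x.parity par) a)) (nprod par l (gen par x) v)) -
        ∑ i ∈ Finset.range I, Ks par (tw par q a) (nprod par i (gen par x) b) v i m n := by
    have zK : ∀ i : ℕ, EZ fun k : ℕ => ((-1 : ℂ) ^ i * (i + k).choose k) •
        nprod par (n - k - 1 - i) (nprod par i (gen par x) b) (nprod par (m + k) (tw par q a) v) :=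
      fun i => Ks_EZ' par _ _ v m n i _
    have z1 : EZ fun k : ℕ => cre par k x * nprod par n b (nprod par (m + k) (tw par q a) v) :=
      (nprod_EZ par m (tw par q a) v).map (fun k w => cre par k x * nprod par n b w) (by simp)
    have e4 : ∀ k : ℕ, ksign q (x.parity par) •
        nprod par n b (cre par k x * nprod par (m + k) (tw par q a) v) =
        cre par k x * nprod par n b (nprod par (m + k) (tw par q a) v) -
        ∑ i ∈ Finset.range I, ((-1 : ℂ) ^ i * (i + k).choose k) •
        nprod par (n - k - 1 - i) (nprod par i (gen par x) b)
          (nprod par (m + k) (tw par q a) v) := by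
      intro k
      rw [comm_neg par k x n b _ hI, tw_of_mem par hb, map_smul, LinearMap.smul_apply, ksign_comm]
      abel
    have z0 : EZ fun k : ℕ => cre par k x * nprod par (m + k) (tw par q a) v :=
      left_EZ1 par m x _ v
    rw [map_mul, tw_gen, smul_mul_assoc, map_smul, LinearMap.smul_apply, map_smul,
      nprod_gen_mul_left, map_add, map_esum z0,
      esum_eq_sum (K := L) (f := fun l : ℕ => nprod par (m - 1 - l) _ _)
        (fun l hl => by simp only [hL l hl, map_zero]),
      smul_add, smul_esum _ (z0.map (fun _ w => nprod par n b w) (by simp)), map_sum]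
    simp only [e4]
    rw [esum_sub z1 (EZ.sum _ fun i _ => zK i), esum_sum _ fun i _ => zK i, tw_comm]
    simp only [Ks]
    abel
  have e5 : (esum fun k : ℕ => cre par k x * Com par q a b v (m + k) n) =
      (esum fun k : ℕ => cre par k x * nprod par (m + k) a (nprod par n b v)) -
      esum fun k : ℕ => cre par k x * nprod par n b (nprod par (m + k) (tw par q a) v) := by
    rw [← esum_sub (left_EZ1 par m x a _)
      ((nprod_EZ par m (tw par q a) v).map (fun k w => cre par k x * nprod par n b w) (by simp))]
    simp only [Com, mul_sub]
  have e6 : ∀ l : ℕ, shf (-1 - l) 0 (Com par q (tw par (x.parity par) a) b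
      (nprod par l (gen par x) v)) m n =
      nprod par (m - 1 - l) (tw par (x.parity par) a) (nprod par n b (nprod par l (gen par x) v)) -
      nprod par n b (nprod par (m - 1 - l) (tw par q (tw par (x.parity par) a))
        (nprod par l (gen par x) v)) := by
    intro l
    change Com par q _ b _ (m + (-1 - l)) (n + 0) = _
    rw [add_zero, show m + (-1 - (l : ℤ)) = m - 1 - l by ring, Com]
  rw [e5, Com, e1, e3]
  simp only [e6, Finset.sum_sub_distrib, Finset.sum_add_distrib, smul_sub]
  abel

theorem Com_EZ (q : ZMod 2) (a b v : Fock par) (m n : ℤ) :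
    EZ fun k : ℕ => Com par q a b v (m + k) n :=
  (nprod_EZ par m a _).sub ((nprod_EZ par m (tw par q a) v).map (fun _ w => nprod par n b w) (by simp))

theorem nprod_mem {p q : ZMod 2} {a b : Fock par} (ha : a ∈ grade par p) (hb : b ∈ grade par q)
    (n : ℤ) : nprod par n a b ∈ grade par (p + q) := by
  rw [mem_grade, nprod_tw, tw_of_mem par ha, tw_of_mem par hb, map_smul, map_smul,
    LinearMap.smul_apply, smul_smul, ksign_add_right, mul_comm]

theorem HK_dl (q : ZMod 2) (r : ZMod 2) (a y v : Fock par) (i N : ℕ)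
    (h : (dl ^ N) (Com par (r + q) (tw par r a) y v) = 0) :
    (dl ^ (N + (i + 1))) (Hs par (tw par r a) y v i + Ks par (tw par q a) y v i) = 0 := by
  rw [pow_add, Module.End.mul_apply]
  suffices (dl ^ (i + 1)) (Hs par (tw par r a) y v i + Ks par (tw par q a) y v i) =
      Com par (r + q) (tw par r a) y v by rw [this, h]
  induction i with
  | zero =>
    rw [zero_add, pow_one, map_add, dl_Hs_zero, dl_Ks_zero]
    funext m n
    rw [Com, tw_tw, add_comm r q, add_assoc, CharTwo.add_self_eq_zero, add_zero, sub_eq_add_neg]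
    rfl
  | succ i ih => rw [pow_succ, Module.End.mul_apply, map_add, dl_Hs_succ, dl_Ks_succ, ih]

theorem locality (a : Fock par) {q : ZMod 2} {b : Fock par} (hb : b ∈ grade par q) :
    ∃ N : ℕ, ∀ v, (dl ^ N) (Com par q a b v) = 0 := by
  induction a using Fock.ind generalizing q b with
  | one =>
    refine ⟨0, fun v => ?_⟩
    funext m n
    simp only [pow_zero, Module.End.one_apply, Com, map_one, nprod_one_left]
    split_ifs <;> simp
  | add u w hu hw =>
    obtain ⟨N, hN⟩ := hu hb
    obtain ⟨M, hM⟩ := hw hb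
    refine ⟨max N M, fun v => ?_⟩
    have : Com par q (u + w) b v = Com par q u b v + Com par q w b v := by
      funext m n
      simp only [Com, map_add, LinearMap.add_apply, Pi.add_apply]
      abel
    rw [this, map_add, dl_pow_mono (le_max_left _ _) (hN v), dl_pow_mono (le_max_right _ _) (hM v),
      add_zero]
  | smul c u hu =>
    obtain ⟨N, hN⟩ := hu hb
    refine ⟨N, fun v => ?_⟩
    have : Com par q (c • u) b v = c • Com par q u b v := by
      funext m n
      simp only [Com, map_smul, LinearMap.smul_apply, Pi.smul_apply, smul_sub]
    rw [this, map_smul, hN, smul_zero]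
  | mul x a ha =>
    have htw : ∀ {q : ZMod 2} (r : ZMod 2) {b : Fock par}, b ∈ grade par q →
        ∃ N : ℕ, ∀ v, (dl ^ N) (Com par q (tw par r a) b v) = 0 := by
      intro q r b hb
      obtain ⟨N, hN⟩ := ha hb
      refine ⟨N, fun v => ?_⟩
      funext m n
      rw [dl_pow_apply]
      simp only [Com_tw par r a hb]
      have := congrArg (fun w => ksign r q • tw par r w) (congrFun (congrFun (hN (tw par r v)) m) n)
      simp only [dl_pow_apply, map_sum, Finset.smul_sum, map_smul, Pi.zero_apply, map_zero,
        smul_zero] at this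
      change _ = (0 : Fock par)
      simpa only [smul_comm _ (ksign r q)] using this
    obtain ⟨N, hN⟩ := ha hb
    obtain ⟨N', hN'⟩ := htw (x.parity par) hb
    obtain ⟨I, hI⟩ := gen_EZ par x b
    choose M hM using fun i : ℕ => htw (x.parity par) (nprod_mem par (gen_mem par x) hb i)
    refine ⟨max (max N N') (∑ i ∈ Finset.range I, (M i + (i + 1))), fun v => ?_⟩
    obtain ⟨L, hL⟩ := gen_EZ par x v
    rw [Com_gen_mul par x a hb v hI hL, map_add, map_add, map_smul, map_sum, map_sum,
      dl_pow_mono (le_trans (le_max_left _ _) (le_max_left _ _))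
        (esum_dl_pow N _ (Com_EZ par q a b v) _ (hN v)), zero_add,
      Finset.sum_eq_zero (s := Finset.range L), smul_zero, zero_add, Finset.sum_eq_zero]
    · intro i hi
      refine dl_pow_mono (le_trans ?_ (le_max_right _ _)) (HK_dl par q _ a _ v i (M i) (hM i v))
      exact Finset.single_le_sum (f := fun i => M i + (i + 1)) (fun _ _ => Nat.zero_le _) hi
    · intro l _
      rw [← Module.End.mul_apply, ((dl_shf _ _).pow_left _).eq, Module.End.mul_apply,
        dl_pow_mono (le_trans (le_max_right _ _) (le_max_left _ _)) (hN' _), map_zero]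


/-! ## The SUSY charged free fermion vertex algebra -/

/-- The modes `a_(j|1) = a_(j)` and `a_(j|0) = (D a)_(j)`. -/
noncomputable def smode (j : ℤ) (ε : ZMod 2) : Fock par →ₗ[ℂ] Fock par →ₗ[ℂ] Fock par :=
  if ε = 1 then nprod par j else nprod par j ∘ₗ D par

theorem smode_one (j : ℤ) : smode par j 1 = nprod par j := if_pos rfl

theorem smode_zero (j : ℤ) : smode par j 0 = nprod par j ∘ₗ D par := if_neg (by decide)

theorem smode_eq (ε : ZMod 2) : ∃ d : Fock par →ₗ[ℂ] Fock par,
    (∀ j, smode par j ε = nprod par j ∘ₗ d) ∧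
    ∀ {p : ZMod 2} {a : Fock par}, a ∈ grade par p → d a ∈ grade par (p + ε + 1) := by
  rcases (by revert ε; decide : ε = 0 ∨ ε = 1) with rfl | rfl
  · exact ⟨D par, smode_zero par, fun h => by rw [add_zero]; exact D_mem par h⟩
  · refine ⟨LinearMap.id, fun j => smode_one par j, fun {p a} h => ?_⟩
    rw [add_assoc, CharTwo.add_self_eq_zero, add_zero]; exact h

/-- The SUSY charged free fermion vertex algebra of the superspace with the homogeneous basis `A`,
the basis vector `a` having the parity `par a`. -/
noncomputable def fch : NK1SUSYVertexAlgebra (Fock par) where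
  grade := grade par
  isCompl := isCompl_grade par
  vac := 1
  vac_mem := by rw [mem_grade]; simp
  D := D par
  D_mem := D_mem par
  mode := smode par
  mode_finite ε a b := by
    obtain ⟨d, hd, -⟩ := smode_eq par ε
    simp only [hd]
    exact nprod_bound par b (d a)
  mode_mem j ε {p q a b} ha hb := by
    obtain ⟨d, hd, hm⟩ := smode_eq par ε
    rw [hd, show p + q + ε + 1 = (p + ε + 1) + q by ring]
    exact nprod_mem par (hm ha) hb j
  D_vac := D_one par
  mode_vac j ε a hj := by
    obtain ⟨d, hd, -⟩ := smode_eq par ε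
    rw [hd]
    exact (nprod_one_right par j _).trans (base_nonneg par hj _)
  mode_neg_one_vac a := by rw [smode_one, nprod_one_right, base_neg_one]
  translation_one j {p a} ha b := by
    rw [smode_one, smode_zero, nprod_D, tw_of_mem par ha, map_smul, LinearMap.smul_apply,
      LinearMap.comp_apply]
    abel
  translation_zero j {p a} ha b := by
    have h := nprod_T par j a b
    rw [T, LinearMap.comp_apply] at h
    rw [smode_one, smode_zero, LinearMap.comp_apply, nprod_D, tw_of_mem par (D_mem par ha),
      map_smul, LinearMap.smul_apply, ← h]
    abel
  locality {p q a b} ha hb := by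
    choose d hd hm using smode_eq par
    choose M hM using fun ε ε' : ZMod 2 => locality par (d ε a) (hm ε' hb)
    refine ⟨∑ ε, ∑ ε', M ε ε', fun ε ε' m n v => ?_⟩
    have h1 : M ε ε' ≤ ∑ ε, ∑ ε', M ε ε' :=
      (Finset.single_le_sum (f := fun ε' => M ε ε') (fun _ _ => Nat.zero_le _)
        (Finset.mem_univ ε')).trans (Finset.single_le_sum (f := fun ε => ∑ ε', M ε ε')
          (fun _ _ => Nat.zero_le _) (Finset.mem_univ ε))
    have h2 := congrFun (congrFun (dl_pow_mono h1 (hM ε ε' v)) m) n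
    rw [dl_pow_apply] at h2
    simp only [Com, tw_of_mem par (hm ε ha), map_smul, LinearMap.smul_apply,
      ksign_comm (q + ε' + 1)] at h2
    simp only [hd, LinearMap.comp_apply]
    exact h2

/-- The generator `φ_a`. -/
noncomputable def phi (a : A) : Fock par := gen par ⟨false, a, 0⟩

/-- The generator `φ^{ā}`. -/
noncomputable def phibar (a : A) : Fock par := gen par ⟨true, a, 0⟩

/-! The next facts identify the structure: the generators `D^n φ_a` and `D^n φ^{ā}` are the
iterates of `D` on `φ_a` and `φ^{ā}`, the monomials are their iterated normally ordered products, and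
the `Λ`-brackets are `[φ_a _Λ φ^{b̄}] = δ_{ab}`, `[φ_a _Λ φ_b] = [φ^{ā} _Λ φ^{b̄}] = 0`. -/

theorem iterate_D_gen (up : Bool) (a : A) (n : ℕ) :
    (fch par).D^[n] (gen par ⟨up, a, 0⟩) = gen par ⟨up, a, n⟩ := by
  induction n with
  | zero => rfl
  | succ n ih => rw [Function.iterate_succ_apply', ih]; exact D_gen par _

theorem nop_gen (x : Gen A) (v : Fock par) : (fch par).nop (gen par x) v = gen par x * v := by
  have := nprod_negSucc_gen par 0 x v
  simpa [fch, NK1SUSYVertexAlgebra.nop, smode_one, cre, Gen.shift_zero] using this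

open Classical in
theorem bracket_gen (up up' : Bool) (a b : A) :
    (fch par).bracket (gen par ⟨up, a, 0⟩) (gen par ⟨up', b, 0⟩) =
      if up ≠ up' ∧ a = b then lamChi 0 0 (fch par).vac else 0 := by
  have h0 : ∀ (x y : Gen A) (j : ℕ), nprod par j (gen par x) (gen par y) = kap par x y j • 1 := by
    intro x y j
    have := nprod_gen_gen_mul par j x y 1
    rwa [mul_one, nprod_gen_one par (by simp), mul_zero, smul_zero, zero_add] at this
  ext ⟨j, ε⟩
  change ((j.factorial : ℂ)⁻¹) • smode par j ε _ _ = _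
  rcases (by revert ε; decide : ε = 0 ∨ ε = 1) with rfl | rfl
  · rw [smode_zero, LinearMap.comp_apply, D_gen, h0]
    by_cases hj : j = 0
    · subst hj
      by_cases h : up ≠ up' ∧ a = b
      · rw [if_pos h, kap_pos par ⟨h.1, h.2, rfl⟩]
        simp [kcoef, Gen.succ, lamChi, fch]
      · rw [if_neg h, kap_neg par (fun h' => h ⟨h'.1, h'.2.1⟩)]
        simp
    · rw [kap_neg par (by simp only [Gen.succ]; omega)]
      split_ifs
      · simp [lamChi, hj]
      · simp
  · rw [smode_one, h0, kap_neg par (by simp only; omega)]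
    split_ifs
    · simp [lamChi]
    · simp

theorem bracket_phi_phibar [DecidableEq A] (a b : A) :
    (fch par).bracket (phi par a) (phibar par b) =
      if a = b then lamChi 0 0 (fch par).vac else 0 := by
  rw [phi, phibar, bracket_gen]; simp

theorem bracket_phi_phi (a b : A) : (fch par).bracket (phi par a) (phi par b) = 0 := by
  rw [phi, phi, bracket_gen]; simp

theorem bracket_phibar_phibar (a b : A) : (fch par).bracket (phibar par a) (phibar par b) = 0 := by
  rw [phibar, phibar, bracket_gen]; simp

variable [Fintype A] (t : A → ℂ)

/-- The shifted superconformal vector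
`∑_{a even} ((t_a+1) :∂φ_a φ^{ā}: + t_a :φ_a ∂φ^{ā}: + :Dφ_a Dφ^{ā}:)
+ ∑_{a odd} (t_a :∂φ_a φ^{ā}: + (t_a+1) :φ_a ∂φ^{ā}: + :Dφ_a Dφ^{ā}:)`. -/
noncomputable def Tsh : Fock par :=
  let S := fch par
  ∑ a with par a = 0, ((t a + 1) • S.nop (S.del (phi par a)) (phibar par a) +
    t a • S.nop (phi par a) (S.del (phibar par a)) + S.nop (S.D (phi par a)) (S.D (phibar par a))) +
  ∑ a with par a = 1, (t a • S.nop (S.del (phi par a)) (phibar par a) +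
    (t a + 1) • S.nop (phi par a) (S.del (phibar par a)) +
      S.nop (S.D (phi par a)) (S.D (phibar par a)))

/-- The standard current `∑_{a even} :Dφ_a φ^{ā}: + ∑_{a odd} :Dφ^{ā} φ_a:`. -/
noncomputable def Jst : Fock par :=
  let S := fch par
  ∑ a with par a = 0, S.nop (S.D (phi par a)) (phibar par a) +
  ∑ a with par a = 1, S.nop (S.D (phibar par a)) (phi par a)

/-- The ghost current
`∑_{a even} t_a (:Dφ_a φ^{ā}: + :φ_a Dφ^{ā}:) + ∑_{a odd} t_a (:Dφ^{ā} φ_a: + :φ^{ā} Dφ_a:)`. -/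
noncomputable def Jghost : Fock par :=
  let S := fch par
  ∑ a with par a = 0, t a • (S.nop (S.D (phi par a)) (phibar par a) +
    S.nop (phi par a) (S.D (phibar par a))) +
  ∑ a with par a = 1, t a • (S.nop (S.D (phibar par a)) (phi par a) +
    S.nop (phibar par a) (S.D (phi par a)))

/-- The shifted current. -/
noncomputable def Jsh : Fock par := Jst par + Jghost par t

/-- The central charge `∑_a (6 t_a + 3)`. -/
noncomputable def csh : ℂ := ∑ a, (6 * t a + 3)

end Fock

end SusyVA

/-! # The `N = 2` structure of the shifted currents

For every `a`, one of `φ_a`, `φ^{ā}` is even and the other odd.  Call their derivatives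
`β_k = D^k β` (the even one being `β`, `evenGen`) and `γ_k = D^k γ` (`oddGen`).  The contraction of
`β` with `γ` is the same in both cases, and by supercommutativity so are the vectors in question:
with `s = t_a` the summands at `a` are
`(s + 1) β_2 γ_0 + s β_0 γ_2 + β_1 γ_1` (`superconformalAt`) and `(s + 1) β_1 γ_0 + s β_0 γ_1`
(`currentAt`).

All products are computed by Wick's formula, which for two quadratic vectors has single and double
contractions only.  Contractions between different `a` vanish, so everything is a sum over `a`
(`nprod_sum_sum`).  Counting the powers of `D` (`quad`), a double contraction in an `n`-th product
takes total order exactly `2n`, and a single one takes at least `2n + 1`, whence most products vanish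
(`nprod_quad_quad_of_lt`); finitely many explicit ones remain.
The modes are `u_(n|1) = u_(n)` and `u_(n|0) = (D u)_(n)`, so the superconformal vector, the current
and their images under `D` have to be multiplied.

The products that involve more structure come from the zero modes.  When contractions of `u` are
linear in the generators and contribute no second contraction, `u_(n)` is a superderivation
(`nprod_gen_mul_of_linear`).  For `T = Tsh` this gives `T_(0|1) = D`, by comparison on the generators,
and then `T_(0|0) = 2∂` by translation covariance; and it shows that `T_(1|0)` is a derivation with
the generators as eigenvectors, so that the monomials are eigenvectors and `T_(1|0)` is
diagonalizable. -/

namespace SusyVA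

section Currents

variable {A : Type*} (par : A → ZMod 2)

/-! ### Quadratic vectors -/

/-- The span of the products of two generators attached to the basis vector `a` and of total
order `N`, where `D^n φ_a` and `D^n φ^{ā}` have order `n`. -/
noncomputable def quad (a : A) (N : ℕ) : Submodule ℂ (Fock par) :=
  Submodule.span ℂ {v | ∃ x y : Gen A, x.idx = a ∧ y.idx = a ∧ x.ord + y.ord = N ∧
    v = gen par x * gen par y}

theorem gen_mul_gen_mem_quad {a : A} {N : ℕ} {x y : Gen A} (hx : x.idx = a) (hy : y.idx = a)
    (h : x.ord + y.ord = N) : gen par x * gen par y ∈ quad par a N :=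
  Submodule.subset_span ⟨x, y, hx, hy, h, rfl⟩

theorem rd_gen_mul_gen (z : Gen A) (j : ℕ) (x y : Gen A) :
    rd par z j (gen par x * gen par y) = kap par y z j • gen par x +
      (kap par x z j * ksign (z.parity par) (y.parity par)) • gen par y := by
  simp [rd_gen_mul, smul_smul]

theorem D_mem_quad {a : A} {N : ℕ} {u : Fock par} (hu : u ∈ quad par a N) :
    D par u ∈ quad par a (N + 1) := by
  induction hu using Submodule.span_induction with
  | mem u h =>
    obtain ⟨x, y, hx, hy, h, rfl⟩ := h
    rw [D_gen_mul, D_gen]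
    exact Submodule.add_mem _
      (Submodule.smul_mem _ _ (gen_mul_gen_mem_quad par hx hy (by simp only [Gen.succ]; omega)))
      (gen_mul_gen_mem_quad par hx hy (by simp only [Gen.succ]; omega))
  | zero => simp
  | add u v _ _ hu hv => rw [map_add]; exact Submodule.add_mem _ hu hv
  | smul c u _ hu => rw [map_smul]; exact Submodule.smul_mem _ _ hu

theorem rd_quad_eq_zero_of_lt {a : A} {N : ℕ} {u : Fock par} (hu : u ∈ quad par a N) {z : Gen A}
    {j : ℕ} (h : N + z.ord < 2 * j + 1) : rd par z j u = 0 := by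
  induction hu using Submodule.span_induction with
  | mem u hu =>
    obtain ⟨x, y, hx, hy, hN, rfl⟩ := hu
    rw [rd_gen_mul_gen, kap_neg par (by omega), kap_neg par (by omega)]
    simp
  | zero => simp
  | add u v _ _ hu hv => rw [map_add, hu, hv, add_zero]
  | smul c u _ hu => rw [map_smul, hu, smul_zero]

theorem rd_quad_eq_zero_of_ne {a : A} {N : ℕ} {u : Fock par} (hu : u ∈ quad par a N) {z : Gen A}
    (h : z.idx ≠ a) (j : ℕ) : rd par z j u = 0 := by
  induction hu using Submodule.span_induction with
  | mem u hu =>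
    obtain ⟨x, y, hx, hy, hN, rfl⟩ := hu
    rw [rd_gen_mul_gen, kap_neg par fun h' => h (h'.2.1.symm.trans hy),
      kap_neg par fun h' => h (h'.2.1.symm.trans hx)]
    simp
  | zero => simp
  | add u v _ _ hu hv => rw [map_add, hu, hv, add_zero]
  | smul c u _ hu => rw [map_smul, hu, smul_zero]

theorem rd_quad_mem_span {a : A} {N : ℕ} {u : Fock par} (hu : u ∈ quad par a N) (z : Gen A)
    (j : ℕ) : rd par z j u ∈ Submodule.span ℂ (Set.range (gen par)) := by
  induction hu using Submodule.span_induction with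
  | mem u hu =>
    obtain ⟨x, y, -, -, -, rfl⟩ := hu
    rw [rd_gen_mul_gen]
    exact Submodule.add_mem _ (Submodule.smul_mem _ _ (Submodule.subset_span ⟨x, rfl⟩))
      (Submodule.smul_mem _ _ (Submodule.subset_span ⟨y, rfl⟩))
  | zero => simp
  | add u v _ _ hu hv => rw [map_add]; exact Submodule.add_mem _ hu hv
  | smul c u _ hu => rw [map_smul]; exact Submodule.smul_mem _ _ hu

/-! ### Products with quadratic vectors -/

/-- An `n`-th product with a generator, `n ≥ 0`, is given by single contractions; those with
`j < n` drop out, as `base` vanishes at nonnegative indices. -/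
theorem nprod_gen_right (n : ℕ) (u : Fock par) (z : Gen A) :
    nprod par n u (gen par z) = esum fun j : ℕ => base par (n - j - 1) (rd par z j u) := by
  have := nprod_gen_mul par n u z 1
  rw [mul_one, nprod_one_right, base_nonneg par (by simp), mul_zero, zero_add] at this
  simpa only [nprod_one_right] using this

theorem nprod_quad_gen_of_ne (n : ℕ) {a : A} {N : ℕ} {u : Fock par} (hu : u ∈ quad par a N)
    {z : Gen A} (h : z.idx ≠ a) : nprod par n u (gen par z) = 0 := by
  rw [nprod_gen_right, esum_eq_zero]
  intro j
  rw [rd_quad_eq_zero_of_ne par hu h, map_zero]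

theorem nprod_sum_gen [Fintype A] (n : ℕ) {N : ℕ} {F : A → Fock par}
    (hF : ∀ a, F a ∈ quad par a N) (z : Gen A) :
    nprod par n (∑ a, F a) (gen par z) = nprod par n (F z.idx) (gen par z) := by
  rw [map_sum, LinearMap.sum_apply, Finset.sum_eq_single z.idx]
  · exact fun a _ h => nprod_quad_gen_of_ne par n (hF a) h.symm
  · simp

theorem nprod_quad_quad_of_ne (n : ℕ) {a b : A} (hab : a ≠ b) {N M : ℕ} {u v : Fock par}
    (hu : u ∈ quad par a N) (hv : v ∈ quad par b M) : nprod par n u v = 0 := by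
  induction hv using Submodule.span_induction with
  | mem v hv =>
    obtain ⟨z, w, hz, hw, -, rfl⟩ := hv
    have h : ∀ {z : Gen A}, z.idx = b → ∀ j, rd par z j u = 0 := fun hz j =>
      rd_quad_eq_zero_of_ne par hu (by rw [hz]; exact hab.symm) j
    rw [nprod_gen_mul, nprod_gen_right, esum_eq_zero, esum_eq_zero, mul_zero, zero_add]
    · intro j; rw [h hz]; simp
    · intro j; rw [rd_tw, h hw]; simp
  | zero => simp
  | add u v _ _ hu hv => rw [map_add, hu, hv, add_zero]
  | smul c u _ hu => rw [map_smul, hu, smul_zero]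

theorem nprod_sum_sum [Fintype A] (n : ℕ) {N M : ℕ} {F G : A → Fock par}
    (hF : ∀ a, F a ∈ quad par a N) (hG : ∀ a, G a ∈ quad par a M) :
    nprod par n (∑ a, F a) (∑ a, G a) = ∑ a, nprod par n (F a) (G a) := by
  rw [map_sum (nprod par n), LinearMap.sum_apply]
  refine Finset.sum_congr rfl fun a _ => ?_
  rw [map_sum, Finset.sum_eq_single a]
  · exact fun b _ h => nprod_quad_quad_of_ne par n h.symm (hF a) (hG b)
  · simp

theorem nprod_gen_gen (n : ℕ) (x y : Gen A) :
    nprod par n (gen par x) (gen par y) = kap par x y n • 1 := by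
  have := nprod_gen_gen_mul par n x y 1
  rwa [mul_one, nprod_gen_one par (by simp), mul_zero, smul_zero, zero_add] at this

/-- A double contraction in an `n`-th product uses up the total order `2n`, and a single one uses
up at least `2n + 1`. -/
theorem nprod_quad_quad_of_lt {n : ℕ} {a b : A} {N M : ℕ} (h : N + M < 2 * n) {u v : Fock par}
    (hu : u ∈ quad par a N) (hv : v ∈ quad par b M) : nprod par n u v = 0 := by
  induction hv using Submodule.span_induction with
  | mem v hv =>
    obtain ⟨z, w, -, -, hM, rfl⟩ := hv
    rw [nprod_gen_mul, nprod_gen_right, esum_eq_zero, esum_eq_zero, mul_zero, zero_add]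
    · intro j
      rcases lt_or_ge j n with hj | hj
      · have e : ((n : ℤ) - j - 1) = ((n - j - 1 : ℕ) : ℤ) := by omega
        rw [e]
        induction hu using Submodule.span_induction with
        | mem u hu =>
          obtain ⟨x, y, -, -, hN, rfl⟩ := hu
          have h1 : kap par y z j * kap par x w (n - j - 1) = 0 := by
            by_cases h1 : y.ord + z.ord = 2 * j + 1
            · rw [kap_neg par (x := x) (by omega), mul_zero]
            · rw [kap_neg par (x := y) (by omega), zero_mul]
          have h2 : kap par x z j * kap par y w (n - j - 1) = 0 := by
            by_cases h1 : x.ord + z.ord = 2 * j + 1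
            · rw [kap_neg par (x := y) (by omega), mul_zero]
            · rw [kap_neg par (x := x) (by omega), zero_mul]
          rw [rd_gen_mul_gen, map_add, map_smul, map_smul, LinearMap.add_apply,
            LinearMap.smul_apply, LinearMap.smul_apply, nprod_gen_gen, nprod_gen_gen, smul_smul,
            smul_smul, h1, mul_right_comm, h2]
          simp
        | zero => simp
        | add u v _ _ hu hv => simp only [map_add, LinearMap.add_apply, hu, hv, add_zero]
        | smul c u _ hu => simp only [map_smul, LinearMap.smul_apply, hu, smul_zero]
      · rw [rd_quad_eq_zero_of_lt par hu (by omega)]; simp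
    · intro j
      rcases lt_or_ge j n with hj | hj
      · rw [base_nonneg par (by omega)]
      · rw [rd_tw, rd_quad_eq_zero_of_lt par hu (by omega)]; simp
  | zero => simp
  | add u v _ _ hu hv => rw [map_add, hu, hv, add_zero]
  | smul c u _ hu => rw [map_smul, hu, smul_zero]

/-- If all the contractions of `u` are linear in the generators and no further contractions
contribute, `u_(n)` is a superderivation. -/
theorem nprod_gen_mul_of_linear (n : ℕ) {u : Fock par} {z : Gen A}
    (hu : ∀ j, rd par z j u ∈ Submodule.span ℂ (Set.range (gen par)))
    (h : ∀ j < n, ∀ b, nprod par (n - j - 1) (rd par z j u) b = 0) (b : Fock par) :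
    nprod par n u (gen par z * b) = gen par z * nprod par n (tw par (z.parity par) u) b +
      nprod par n u (gen par z) * b := by
  rw [nprod_gen_mul, nprod_gen_right]
  congr 1
  have hE : EZ fun j : ℕ => base par (n - j - 1) (rd par z j u) :=
    contr_EZ par z (base par) n u
  refine Eq.trans ?_ (map_esum hE (LinearMap.mulRight ℂ b)).symm
  congr 1
  funext j
  rcases lt_or_ge j n with hj | hj
  · rw [h j hj, base_nonneg par (by omega), map_zero]
  · replace hu := hu j
    obtain ⟨k, hk⟩ : ∃ k, (n : ℤ) - j - 1 = Int.negSucc k := ⟨j - n, by omega⟩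
    rw [hk]
    generalize rd par z j u = l at hu
    induction hu using Submodule.span_induction with
    | mem u hu =>
      obtain ⟨x, rfl⟩ := hu
      rw [nprod_negSucc_gen, ← nprod_one_right, nprod_negSucc_gen]
      simp
    | zero => simp
    | add u v _ _ hu hv => simp only [map_add, LinearMap.add_apply, hu, hv]
    | smul c u _ hu => simp only [map_smul, LinearMap.smul_apply, hu]

/-- `x_(0) = 0` for a generator `x` in the image of `∂`. -/
theorem nprod_zero_gen_eq_zero {x : Gen A} (hx : 2 ≤ x.ord) (b : Fock par) :
    nprod par 0 (gen par x) b = 0 := by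
  have e : gen par x = T par (gen par ⟨x.up, x.idx, x.ord - 2⟩) := by
    rw [T_gen, Gen.shift]
    congr 1
    ext <;> simp
    omega
  rw [e, nprod_T]
  simp

/-- For `N ≥ 3` a contraction with `j = 0`, which takes total order one, leaves a generator of order
at least two, hence in the image of `∂`. -/
theorem nprod_zero_rd_quad {a : A} {N : ℕ} (hN : 3 ≤ N) {u : Fock par} (hu : u ∈ quad par a N)
    (z : Gen A) (b : Fock par) : nprod par 0 (rd par z 0 u) b = 0 := by
  induction hu using Submodule.span_induction with
  | mem u hu =>
    obtain ⟨x, y, -, -, h, rfl⟩ := hu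
    rw [rd_gen_mul_gen, map_add, map_smul, map_smul, LinearMap.add_apply, LinearMap.smul_apply,
      LinearMap.smul_apply]
    have h1 : kap par y z 0 • nprod par 0 (gen par x) b = 0 := by
      by_cases h1 : y.ord ≤ 1
      · rw [nprod_zero_gen_eq_zero par (by omega), smul_zero]
      · rw [kap_neg par (by omega), zero_smul]
    have h2 : (kap par x z 0 * ksign (z.parity par) (y.parity par)) •
        nprod par 0 (gen par y) b = 0 := by
      by_cases h1 : x.ord ≤ 1
      · rw [nprod_zero_gen_eq_zero par (by omega), smul_zero]
      · rw [kap_neg par (by omega), zero_mul, zero_smul]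
    rw [h1, h2, add_zero]
  | zero => simp
  | add u v _ _ hu hv => simp only [map_add, LinearMap.add_apply, hu, hv, add_zero]
  | smul c u _ hu => simp only [map_smul, LinearMap.smul_apply, hu, smul_zero]

/-- Wick's formula for the product of a quadratic vector with a product of two generators.  At low
orders only the contractions with `j < 3` occur. -/
theorem nprod_quad_mul_gen (n : ℕ) {a : A} {N : ℕ} {u : Fock par} (hu : u ∈ quad par a N)
    {y z : Gen A} (hy : N + y.ord < 7) (hz : N + z.ord < 7) :
    nprod par n u (gen par y * gen par z) =
      gen par y * (∑ j ∈ Finset.range 3,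
        base par (n - j - 1) (rd par z j (tw par (y.parity par) u))) +
      ∑ j ∈ Finset.range 3, nprod par (n - j - 1) (rd par y j u) (gen par z) := by
  rw [nprod_gen_mul_sum par n u y _ (J := 3) fun j hj =>
    rd_quad_eq_zero_of_lt par hu (by omega), nprod_gen_right, esum_eq_sum (K := 3)]
  intro j hj
  rw [rd_tw, rd_quad_eq_zero_of_lt par hu (by omega)]
  simp

theorem nprod_quad_gen (n : ℕ) {a : A} {N : ℕ} {u : Fock par} (hu : u ∈ quad par a N)
    {z : Gen A} (hz : N + z.ord < 7) : nprod par n u (gen par z) =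
      ∑ j ∈ Finset.range 3, base par (n - j - 1) (rd par z j u) := by
  rw [nprod_gen_right, esum_eq_sum (K := 3)]
  intro j hj
  rw [rd_quad_eq_zero_of_lt par hu (by omega), map_zero]

/-! ### The even and the odd generator of a pair -/

/-- `D^k` applied to the even one of `φ_a` and `φ^{ā}`. -/
def evenGen (a : A) (k : ℕ) : Gen A := ⟨decide (par a = 1), a, k⟩

/-- `D^k` applied to the odd one of `φ_a` and `φ^{ā}`. -/
def oddGen (a : A) (k : ℕ) : Gen A := ⟨!decide (par a = 1), a, k⟩

theorem eq_evenGen_or_eq_oddGen (x : Gen A) :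
    x = evenGen par x.idx x.ord ∨ x = oddGen par x.idx x.ord := by
  obtain ⟨u, a, k⟩ := x
  by_cases h : par a = 1 <;> cases u <;> simp [evenGen, oddGen, h]

theorem evenGen_parity (a : A) (k : ℕ) : (evenGen par a k).parity par = k := by
  rcases (by generalize par a = p; revert p; decide : par a = 0 ∨ par a = 1) with h | h <;>
    simp [evenGen, Gen.parity, gpar, h, CharTwo.add_self_eq_zero]

theorem oddGen_parity (a : A) (k : ℕ) : (oddGen par a k).parity par = k + 1 := by
  rcases (by generalize par a = p; revert p; decide : par a = 0 ∨ par a = 1) with h | h <;>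
    simp [oddGen, Gen.parity, gpar, h, add_comm]

theorem evenGen_succ (a : A) (k : ℕ) : (evenGen par a k).succ = evenGen par a (k + 1) := rfl

theorem oddGen_succ (a : A) (k : ℕ) : (oddGen par a k).succ = oddGen par a (k + 1) := rfl

theorem evenGen_shift (a : A) (k l : ℕ) :
    (evenGen par a k).shift l = evenGen par a (k + 2 * l) := rfl

theorem oddGen_shift (a : A) (k l : ℕ) :
    (oddGen par a k).shift l = oddGen par a (k + 2 * l) := rfl

theorem kap_evenGen_oddGen (a : A) (m n j : ℕ) :
    kap par (evenGen par a m) (oddGen par a n) j =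
      if m + n = 2 * j + 1 then -((-1) ^ (m / 2 + m) * (j.factorial : ℂ)) else 0 := by
  split_ifs with h
  · rw [kap_pos par (by simp [evenGen, oddGen, h]), kcoef, evenGen_parity]
    rcases Nat.even_or_odd m with hm | hm
    · rw [if_pos (by exact hm), pow_add, hm.neg_one_pow, (ZMod.natCast_eq_zero_iff_even).2 hm]
      simp [evenGen]
    · rw [if_neg (by simpa [evenGen] using hm), pow_add, hm.neg_one_pow]
      simp [evenGen]
  · exact kap_neg par fun h' => h h'.2.2

theorem kap_oddGen_evenGen (a : A) (m n j : ℕ) :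
    kap par (oddGen par a m) (evenGen par a n) j =
      if m + n = 2 * j + 1 then (-1) ^ (m / 2) * (j.factorial : ℂ) else 0 := by
  split_ifs with h
  · rw [kap_pos par (by simp [evenGen, oddGen, h]), kcoef, oddGen_parity]
    rcases Nat.even_or_odd m with hm | hm
    · rw [if_pos (by exact hm), (ZMod.natCast_eq_zero_iff_even).2 hm]
      simp [oddGen]
    · rw [if_neg (by simpa [oddGen] using hm)]
      simp [oddGen]
  · exact kap_neg par fun h' => h h'.2.2

theorem kap_evenGen_evenGen (a : A) (m n j : ℕ) :
    kap par (evenGen par a m) (evenGen par a n) j = 0 :=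
  kap_neg par fun h => h.1 rfl

theorem kap_oddGen_oddGen (a : A) (m n j : ℕ) :
    kap par (oddGen par a m) (oddGen par a n) j = 0 :=
  kap_neg par fun h => h.1 rfl

/-! ### The summands of the superconformal vector and of the current -/

/-- The summand of the shifted superconformal vector `Tsh` at `a`, see `Tsh_eq_sum`. -/
noncomputable def superconformalAt (a : A) (s : ℂ) : Fock par :=
  (s + 1) • (gen par (evenGen par a 2) * gen par (oddGen par a 0)) +
  s • (gen par (evenGen par a 0) * gen par (oddGen par a 2)) +
  gen par (evenGen par a 1) * gen par (oddGen par a 1)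

/-- The summand of the shifted current `Jsh` at `a`, see `Jsh_eq_sum`. -/
noncomputable def currentAt (a : A) (s : ℂ) : Fock par :=
  (s + 1) • (gen par (evenGen par a 1) * gen par (oddGen par a 0)) +
  s • (gen par (evenGen par a 0) * gen par (oddGen par a 1))

theorem superconformalAt_mem_quad (a : A) (s : ℂ) : superconformalAt par a s ∈ quad par a 2 := by
  refine Submodule.add_mem _ (Submodule.add_mem _ (Submodule.smul_mem _ _ ?_)
    (Submodule.smul_mem _ _ ?_)) ?_ <;> exact gen_mul_gen_mem_quad par rfl rfl rfl

theorem currentAt_mem_quad (a : A) (s : ℂ) : currentAt par a s ∈ quad par a 1 := by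
  refine Submodule.add_mem _ (Submodule.smul_mem _ _ ?_) (Submodule.smul_mem _ _ ?_) <;>
    exact gen_mul_gen_mem_quad par rfl rfl rfl

theorem superconformalAt_mem_grade (a : A) (s : ℂ) : superconformalAt par a s ∈ grade par 1 := by
  rw [mem_grade]
  simp [superconformalAt, evenGen_parity, oddGen_parity, show (2 : ZMod 2) = 0 by decide,
    CharTwo.add_self_eq_zero]

theorem currentAt_mem_grade (a : A) (s : ℂ) : currentAt par a s ∈ grade par 0 := by
  rw [mem_grade]
  simp [currentAt, evenGen_parity, oddGen_parity, CharTwo.add_self_eq_zero]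

/-! ### Products of the summands -/

theorem nprod_gen_gen_zero (x y : Gen A) :
    nprod par 0 (gen par x) (gen par y) = kap par x y 0 • 1 := nprod_gen_gen par 0 x y

theorem nprod_gen_gen_one (x y : Gen A) :
    nprod par 1 (gen par x) (gen par y) = kap par x y 1 • 1 := nprod_gen_gen par 1 x y

theorem nprod_neg_one_gen (x : Gen A) (b : Fock par) :
    nprod par (-1) (gen par x) b = gen par x * b := by
  have := nprod_negSucc_gen par 0 x b
  simpa [cre, Gen.shift_zero] using this

theorem nprod_neg_two_gen (x : Gen A) (b : Fock par) :
    nprod par (-2) (gen par x) b = gen par (x.shift 1) * b := by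
  have := nprod_negSucc_gen par 1 x b
  simpa [cre] using this

theorem base_neg_two (v : Fock par) : base par (-2) v = T par v := by
  have := base_negSucc par 1 v
  simpa using this

section Evaluation

theorem two_eq_zero_zmod : (2 : ZMod 2) = 0 := by decide

-- With these rules `simp` evaluates every term of Wick's formula for the summands.
attribute [local simp] Finset.sum_range_succ superconformalAt currentAt D_gen_mul evenGen_succ
  oddGen_succ rd_gen_mul_gen kap_evenGen_evenGen kap_oddGen_oddGen kap_evenGen_oddGen
  kap_oddGen_evenGen evenGen_parity oddGen_parity evenGen_shift oddGen_shift base_nonneg base_neg_one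
  base_neg_two nprod_gen_gen_zero nprod_gen_gen_one nprod_neg_one_gen nprod_neg_two_gen T_gen
  two_eq_zero_zmod CharTwo.add_self_eq_zero

theorem nprod_one_superconformalAt_superconformalAt (a : A) (s : ℂ) :
    nprod par 1 (superconformalAt par a s) (superconformalAt par a s) = 0 := by
  have h {y z} := nprod_quad_mul_gen par 1 (superconformalAt_mem_quad par a s) (y := y) (z := z)
  push_cast at h
  conv_lhs => arg 2; rw [superconformalAt]
  simp only [map_add (nprod par 1 _), map_smul (nprod par 1 _)]
  rw [h (by simp [evenGen]) (by simp [oddGen]), h (by simp [evenGen]) (by simp [oddGen]),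
    h (by simp [evenGen]) (by simp [oddGen])]
  simp
  module

theorem nprod_two_superconformalAt_superconformalAt (a : A) (s : ℂ) :
    nprod par 2 (superconformalAt par a s) (superconformalAt par a s) = (4 * s + 2) • 1 := by
  have h {y z} := nprod_quad_mul_gen par 2 (superconformalAt_mem_quad par a s) (y := y) (z := z)
  push_cast at h
  conv_lhs => arg 2; rw [superconformalAt]
  simp only [map_add (nprod par 2 _), map_smul (nprod par 2 _)]
  rw [h (by simp [evenGen]) (by simp [oddGen]), h (by simp [evenGen]) (by simp [oddGen]),
    h (by simp [evenGen]) (by simp [oddGen])]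
  simp
  module

theorem nprod_two_D_superconformalAt_superconformalAt (a : A) (s : ℂ) :
    nprod par 2 (D par (superconformalAt par a s)) (superconformalAt par a s) = 0 := by
  have h {y z} := nprod_quad_mul_gen par 2
    (D_mem_quad par (superconformalAt_mem_quad par a s)) (y := y) (z := z)
  push_cast at h
  conv_lhs => arg 2; rw [superconformalAt]
  simp only [map_add (nprod par 2 _), map_smul (nprod par 2 _)]
  rw [h (by simp [evenGen]) (by simp [oddGen]), h (by simp [evenGen]) (by simp [oddGen]),
    h (by simp [evenGen]) (by simp [oddGen])]
  simp
  module

theorem nprod_one_superconformalAt_currentAt (a : A) (s : ℂ) :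
    nprod par 1 (superconformalAt par a s) (currentAt par a s) = 0 := by
  have h {y z} := nprod_quad_mul_gen par 1 (superconformalAt_mem_quad par a s) (y := y) (z := z)
  push_cast at h
  conv_lhs => arg 2; rw [currentAt]
  simp only [map_add (nprod par 1 _), map_smul (nprod par 1 _)]
  rw [h (by simp [evenGen]) (by simp [oddGen]), h (by simp [evenGen]) (by simp [oddGen])]
  simp
  module

theorem nprod_two_D_superconformalAt_currentAt (a : A) (s : ℂ) :
    nprod par 2 (D par (superconformalAt par a s)) (currentAt par a s) = 0 := by
  have h {y z} := nprod_quad_mul_gen par 2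
    (D_mem_quad par (superconformalAt_mem_quad par a s)) (y := y) (z := z)
  push_cast at h
  conv_lhs => arg 2; rw [currentAt]
  simp only [map_add (nprod par 2 _), map_smul (nprod par 2 _)]
  rw [h (by simp [evenGen]) (by simp [oddGen]), h (by simp [evenGen]) (by simp [oddGen])]
  simp
  module

theorem nprod_zero_currentAt_currentAt (a : A) (s : ℂ) :
    nprod par 0 (currentAt par a s) (currentAt par a s) = 0 := by
  have h {y z} := nprod_quad_mul_gen par 0 (currentAt_mem_quad par a s) (y := y) (z := z)
  push_cast at h
  conv_lhs => arg 2; rw [currentAt]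
  simp only [map_add (nprod par 0 _), map_smul (nprod par 0 _)]
  rw [h (by simp [evenGen]) (by simp [oddGen]), h (by simp [evenGen]) (by simp [oddGen])]
  simp

theorem nprod_one_currentAt_currentAt (a : A) (s : ℂ) :
    nprod par 1 (currentAt par a s) (currentAt par a s) = (2 * s + 1) • 1 := by
  have h {y z} := nprod_quad_mul_gen par 1 (currentAt_mem_quad par a s) (y := y) (z := z)
  push_cast at h
  conv_lhs => arg 2; rw [currentAt]
  simp only [map_add (nprod par 1 _), map_smul (nprod par 1 _)]
  rw [h (by simp [evenGen]) (by simp [oddGen]), h (by simp [evenGen]) (by simp [oddGen])]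
  simp
  module

theorem nprod_zero_D_currentAt_currentAt (a : A) (s : ℂ) :
    nprod par 0 (D par (currentAt par a s)) (currentAt par a s) = superconformalAt par a s := by
  have h {y z} := nprod_quad_mul_gen par 0
    (D_mem_quad par (currentAt_mem_quad par a s)) (y := y) (z := z)
  push_cast at h
  conv_lhs => arg 2; rw [currentAt]
  simp only [map_add (nprod par 0 _), map_smul (nprod par 0 _)]
  rw [h (by simp [evenGen]) (by simp [oddGen]), h (by simp [evenGen]) (by simp [oddGen])]
  simp [mul_add, pow_succ]
  module

theorem nprod_one_D_currentAt_currentAt (a : A) (s : ℂ) :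
    nprod par 1 (D par (currentAt par a s)) (currentAt par a s) = 0 := by
  have h {y z} := nprod_quad_mul_gen par 1
    (D_mem_quad par (currentAt_mem_quad par a s)) (y := y) (z := z)
  push_cast at h
  conv_lhs => arg 2; rw [currentAt]
  simp only [map_add (nprod par 1 _), map_smul (nprod par 1 _)]
  rw [h (by simp [evenGen]) (by simp [oddGen]), h (by simp [evenGen]) (by simp [oddGen])]
  simp
  module

theorem nprod_zero_superconformalAt_evenGen (a : A) (s : ℂ) :
    nprod par 0 (superconformalAt par a s) (gen par (evenGen par a 0)) =
      gen par (evenGen par a 1) := by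
  refine (nprod_quad_gen par 0 (superconformalAt_mem_quad par a s) (by simp [evenGen])).trans ?_
  simp

theorem nprod_zero_superconformalAt_oddGen (a : A) (s : ℂ) :
    nprod par 0 (superconformalAt par a s) (gen par (oddGen par a 0)) =
      gen par (oddGen par a 1) := by
  refine (nprod_quad_gen par 0 (superconformalAt_mem_quad par a s) (by simp [oddGen])).trans ?_
  simp

theorem nprod_zero_D_superconformalAt_evenGen (a : A) (s : ℂ) :
    nprod par 0 (D par (superconformalAt par a s)) (gen par (evenGen par a 0)) =
      (2 : ℂ) • gen par (evenGen par a 2) := by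
  refine (nprod_quad_gen par 0 (D_mem_quad par (superconformalAt_mem_quad par a s))
    (by simp [evenGen])).trans ?_
  simp
  module

theorem nprod_zero_D_superconformalAt_oddGen (a : A) (s : ℂ) :
    nprod par 0 (D par (superconformalAt par a s)) (gen par (oddGen par a 0)) =
      (2 : ℂ) • gen par (oddGen par a 2) := by
  refine (nprod_quad_gen par 0 (D_mem_quad par (superconformalAt_mem_quad par a s))
    (by simp [oddGen])).trans ?_
  simp
  module

theorem nprod_one_D_superconformalAt_evenGen (a : A) (s : ℂ) :
    nprod par 1 (D par (superconformalAt par a s)) (gen par (evenGen par a 0)) =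
      (-s) • gen par (evenGen par a 0) := by
  refine (nprod_quad_gen par 1 (D_mem_quad par (superconformalAt_mem_quad par a s))
    (by simp [evenGen])).trans ?_
  simp

theorem nprod_one_D_superconformalAt_oddGen (a : A) (s : ℂ) :
    nprod par 1 (D par (superconformalAt par a s)) (gen par (oddGen par a 0)) =
      (s + 1) • gen par (oddGen par a 0) := by
  refine (nprod_quad_gen par 1 (D_mem_quad par (superconformalAt_mem_quad par a s))
    (by simp [oddGen])).trans ?_
  simp
  module

end Evaluation

/-! ### Reduction to the summands -/

theorem evenGen_of_par_eq_zero {a : A} (h : par a = 0) (k : ℕ) :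
    evenGen par a k = ⟨false, a, k⟩ := by simp [evenGen, h]

theorem oddGen_of_par_eq_zero {a : A} (h : par a = 0) (k : ℕ) :
    oddGen par a k = ⟨true, a, k⟩ := by simp [oddGen, h]

theorem evenGen_of_par_eq_one {a : A} (h : par a = 1) (k : ℕ) :
    evenGen par a k = ⟨true, a, k⟩ := by simp [evenGen, h]

theorem oddGen_of_par_eq_one {a : A} (h : par a = 1) (k : ℕ) :
    oddGen par a k = ⟨false, a, k⟩ := by simp [oddGen, h]

theorem fch_D_gen (x : Gen A) : (fch par).D (gen par x) = gen par x.succ := D_gen par x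

theorem fch_del_gen (x : Gen A) : (fch par).del (gen par x) = gen par (x.shift 1) := T_gen par x

/-- The `Λ`-bracket in terms of the `n`-th products. -/
theorem bracket_eq_iff {u v : Fock par} {p : LambdaPoly (Fock par)} :
    (fch par).bracket u v = p ↔ ∀ j : ℕ,
      ((j.factorial : ℂ)⁻¹) • nprod par j (D par u) v = p (j, 0) ∧
      ((j.factorial : ℂ)⁻¹) • nprod par j u v = p (j, 1) := by
  have h0 (j : ℕ) : (fch par).bracket u v (j, 0) =
      ((j.factorial : ℂ)⁻¹) • nprod par j (D par u) v := by
    change ((j.factorial : ℂ)⁻¹) • smode par j 0 u v = _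
    rw [smode_zero, LinearMap.comp_apply]
  have h1 (j : ℕ) : (fch par).bracket u v (j, 1) =
      ((j.factorial : ℂ)⁻¹) • nprod par j u v := by
    change ((j.factorial : ℂ)⁻¹) • smode par j 1 u v = _
    rw [smode_one]
  constructor
  · rintro rfl j
    exact ⟨(h0 j).symm, (h1 j).symm⟩
  · intro h
    ext ⟨j, ε⟩
    rcases (by revert ε; decide : ε = 0 ∨ ε = 1) with rfl | rfl
    · rw [h0, (h j).1]
    · rw [h1, (h j).2]

variable [Fintype A] (t : A → ℂ)

theorem sum_filter_par (F G : A → Fock par) :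
    (∑ a with par a = 0, F a) + ∑ a with par a = 1, G a =
      ∑ a, if par a = 0 then F a else G a := by
  rw [Finset.sum_ite]
  congr 2
  ext a
  simp only [Finset.mem_filter, Finset.mem_univ, true_and]
  generalize par a = p
  revert p
  decide

/-- For odd `a`, supercommutativity exchanges the roles of `φ_a` and `φ^{ā}`. -/
theorem Tsh_eq_sum : Tsh par t = ∑ a, superconformalAt par a (t a) := by
  rw [Tsh, sum_filter_par]
  refine Finset.sum_congr rfl fun a _ => ?_
  split_ifs with h
  · simp only [phi, phibar, fch_D_gen, fch_del_gen, nop_gen, superconformalAt,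
      evenGen_of_par_eq_zero par h, oddGen_of_par_eq_zero par h, Gen.succ, Gen.shift]
  · replace h : par a = 1 := by generalize par a = p at h; revert p; decide
    have e (k l : ℕ) : gen par (oddGen par a k) * gen par (evenGen par a l) =
        ksign (k + 1) l • (gen par (evenGen par a l) * gen par (oddGen par a k)) := by
      rw [gen_swap, oddGen_parity, evenGen_parity]
    simp only [evenGen_of_par_eq_one par h,
      oddGen_of_par_eq_one par h] at e
    simp only [phi, phibar, fch_D_gen, fch_del_gen, nop_gen, superconformalAt,
      evenGen_of_par_eq_one par h, oddGen_of_par_eq_one par h, Gen.succ, Gen.shift, e]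
    simp [CharTwo.add_self_eq_zero, show (2 : ZMod 2) = 0 by decide]
    abel

theorem Jsh_eq_sum : Jsh par t = ∑ a, currentAt par a (t a) := by
  rw [Jsh, Jst, Jghost, sum_filter_par, sum_filter_par, ← Finset.sum_add_distrib]
  refine Finset.sum_congr rfl fun a _ => ?_
  split_ifs with h
  · simp only [phi, phibar, fch_D_gen, nop_gen, currentAt,
      evenGen_of_par_eq_zero par h, oddGen_of_par_eq_zero par h, Gen.succ]
    module
  · replace h : par a = 1 := by generalize par a = p at h; revert p; decide
    simp only [phi, phibar, fch_D_gen, nop_gen, currentAt,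
      evenGen_of_par_eq_one par h, oddGen_of_par_eq_one par h, Gen.succ]
    module

theorem Tsh_mem_grade : Tsh par t ∈ grade par 1 := by
  rw [Tsh_eq_sum]
  exact Submodule.sum_mem _ fun a _ => superconformalAt_mem_grade par a (t a)

theorem Jsh_mem_grade : Jsh par t ∈ grade par 0 := by
  rw [Jsh_eq_sum]
  exact Submodule.sum_mem _ fun a _ => currentAt_mem_grade par a (t a)

theorem D_Tsh : D par (Tsh par t) = ∑ a, D par (superconformalAt par a (t a)) := by
  rw [Tsh_eq_sum, map_sum]

theorem D_Jsh : D par (Jsh par t) = ∑ a, D par (currentAt par a (t a)) := by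
  rw [Jsh_eq_sum, map_sum]

/-! ### The zero modes of the superconformal vector -/

/-- Translation covariance, `T_(n|1)` being odd. -/
theorem D_nprod_Tsh (n : ℤ) (b : Fock par) : D par (nprod par n (Tsh par t) b) =
    nprod par n (D par (Tsh par t)) b - nprod par n (Tsh par t) (D par b) := by
  rw [nprod_D, tw_of_mem par (Tsh_mem_grade par t)]
  simp only [ksign_one_one, neg_smul, one_smul, map_neg, LinearMap.neg_apply]
  abel

/-- Translation covariance, `T_(n|0) = (D T)_(n)` being even. -/
theorem D_nprod_D_Tsh (n : ℤ) (b : Fock par) : D par (nprod par n (D par (Tsh par t)) b) =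
    nprod par n (D par (Tsh par t)) (D par b) - (n : ℂ) • nprod par (n - 1) (Tsh par t) b := by
  have h : D par (D par (Tsh par t)) = T par (Tsh par t) := rfl
  rw [nprod_D, tw_of_mem par (D_mem par (Tsh_mem_grade par t)), h, nprod_T,
    CharTwo.add_self_eq_zero, ksign_zero_right, one_smul, neg_smul, ← sub_eq_add_neg]

/-- The two statements are carried from `v` to `D v` by translation covariance, and only together. -/
theorem nprod_zero_Tsh_gen (x : Gen A) :
    nprod par 0 (Tsh par t) (gen par x) = D par (gen par x) ∧
      nprod par 0 (D par (Tsh par t)) (gen par x) = (2 : ℂ) • T par (gen par x) := by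
  obtain ⟨u, a, k⟩ := x
  induction k with
  | zero =>
    have h1 := nprod_sum_gen par 0 (fun a => superconformalAt_mem_quad par a (t a)) ⟨u, a, 0⟩
    have h2 := nprod_sum_gen par 0
      (fun a => D_mem_quad par (superconformalAt_mem_quad par a (t a))) ⟨u, a, 0⟩
    rw [← Tsh_eq_sum] at h1
    rw [← D_Tsh] at h2
    refine ⟨h1.trans ?_, h2.trans ?_⟩
    · rcases eq_evenGen_or_eq_oddGen par ⟨u, a, 0⟩ with h | h <;> rw [h, D_gen]
      · exact nprod_zero_superconformalAt_evenGen par a (t a)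
      · exact nprod_zero_superconformalAt_oddGen par a (t a)
    · rcases eq_evenGen_or_eq_oddGen par ⟨u, a, 0⟩ with h | h <;> rw [h, T_gen]
      · exact nprod_zero_D_superconformalAt_evenGen par a (t a)
      · exact nprod_zero_D_superconformalAt_oddGen par a (t a)
  | succ k ih =>
    have e : gen par ⟨u, a, k + 1⟩ = D par (gen par ⟨u, a, k⟩) := (D_gen par ⟨u, a, k⟩).symm
    have h1 := D_nprod_Tsh par t 0 (gen par ⟨u, a, k⟩)
    have h2 := D_nprod_D_Tsh par t 0 (gen par ⟨u, a, k⟩)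
    rw [ih.1, ih.2, ← e, T] at h1
    rw [ih.2, ← e, map_smul, Int.cast_zero, zero_smul, sub_zero] at h2
    constructor
    · rw [eq_sub_iff_add_eq, ← eq_sub_iff_add_eq'] at h1
      rw [h1, e, LinearMap.comp_apply]
      module
    · rw [← h2, e]
      rfl

theorem rd_Tsh_mem_span (z : Gen A) (j : ℕ) :
    rd par z j (Tsh par t) ∈ Submodule.span ℂ (Set.range (gen par)) := by
  rw [Tsh_eq_sum, map_sum]
  exact Submodule.sum_mem _ fun a _ => rd_quad_mem_span par (superconformalAt_mem_quad par a _) z j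

theorem rd_D_Tsh_mem_span (z : Gen A) (j : ℕ) :
    rd par z j (D par (Tsh par t)) ∈ Submodule.span ℂ (Set.range (gen par)) := by
  rw [D_Tsh, map_sum]
  exact Submodule.sum_mem _ fun a _ =>
    rd_quad_mem_span par (D_mem_quad par (superconformalAt_mem_quad par a _)) z j

/-- `T_(0|1) = D`: both are odd superderivations, and they agree on the generators. -/
theorem nprod_zero_Tsh (b : Fock par) : nprod par 0 (Tsh par t) b = D par b := by
  induction b using Fock.ind with
  | one => rw [nprod_one_right, base_nonneg par le_rfl, D_one]
  | add u v hu hv => rw [map_add, map_add, hu, hv]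
  | smul c u hu => rw [map_smul, map_smul, hu]
  | mul x b hb =>
    have := nprod_gen_mul_of_linear par 0 (rd_Tsh_mem_span par t x) (by simp) b
    rw [Nat.cast_zero, tw_of_mem par (Tsh_mem_grade par t), map_smul, LinearMap.smul_apply, hb,
      (nprod_zero_Tsh_gen par t x).1] at this
    rw [this, D_gen_mul, D_gen, mul_smul_comm, ksign_comm]

theorem nprod_zero_D_Tsh (b : Fock par) :
    nprod par 0 (D par (Tsh par t)) b = (2 : ℂ) • T par b := by
  have h := D_nprod_Tsh par t 0 b
  rw [nprod_zero_Tsh, nprod_zero_Tsh, eq_sub_iff_add_eq] at h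
  rw [← h, two_smul]
  rfl

/-! ### Conformal weights -/

/-- Twice the conformal weight of a generator, that is its eigenvalue under `T_(1|0) = (D T)_(1)`:
it is `-t_a` for the even one of `φ_a` and `φ^{ā}` and `t_a + 1` for the odd one, and `D` raises it by
one. -/
noncomputable def wt (x : Gen A) : ℂ :=
  (if gpar par x.up x.idx = 0 then -t x.idx else t x.idx + 1) + x.ord

theorem nprod_one_D_Tsh_gen (x : Gen A) :
    nprod par 1 (D par (Tsh par t)) (gen par x) = wt par t x • gen par x := by
  obtain ⟨u, a, k⟩ := x
  induction k with
  | zero =>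
    have h2 := nprod_sum_gen par 1
      (fun a => D_mem_quad par (superconformalAt_mem_quad par a (t a))) ⟨u, a, 0⟩
    rw [← D_Tsh] at h2
    refine h2.trans ?_
    rcases eq_evenGen_or_eq_oddGen par ⟨u, a, 0⟩ with h | h
    · have h3 := evenGen_parity par a 0
      simp only [Gen.parity, ← h, Nat.cast_zero, add_zero] at h3
      rw [h, wt, ← h, if_pos h3, Nat.cast_zero, add_zero, h]
      exact nprod_one_D_superconformalAt_evenGen par a (t a)
    · have h3 := oddGen_parity par a 0
      simp only [Gen.parity, ← h, Nat.cast_zero, add_zero, zero_add] at h3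
      rw [h, wt, ← h, if_neg (by rw [h3]; decide), Nat.cast_zero, add_zero, h]
      exact nprod_one_D_superconformalAt_oddGen par a (t a)
  | succ k ih =>
    have e : gen par ⟨u, a, k + 1⟩ = D par (gen par ⟨u, a, k⟩) := (D_gen par ⟨u, a, k⟩).symm
    have h2 := D_nprod_D_Tsh par t 1 (gen par ⟨u, a, k⟩)
    rw [ih, map_smul, sub_self, nprod_zero_Tsh, eq_sub_iff_add_eq] at h2
    rw [e, ← h2]
    simp only [wt]
    push_cast
    module

theorem nprod_one_D_Tsh_gen_mul (x : Gen A) (b : Fock par) :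
    nprod par 1 (D par (Tsh par t)) (gen par x * b) =
      gen par x * nprod par 1 (D par (Tsh par t)) b + wt par t x • (gen par x * b) := by
  have := nprod_gen_mul_of_linear par 1 (rd_D_Tsh_mem_span par t x) (by
    intro j hj b
    obtain rfl : j = 0 := by omega
    rw [D_Tsh, map_sum]
    simp only [Nat.cast_one, Nat.cast_zero, sub_zero, sub_self, map_sum, LinearMap.sum_apply]
    exact Finset.sum_eq_zero fun a _ => nprod_zero_rd_quad par le_rfl
      (D_mem_quad par (superconformalAt_mem_quad par a _)) x b) b
  rw [Nat.cast_one, tw_of_mem par (D_mem par (Tsh_mem_grade par t)), CharTwo.add_self_eq_zero,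
    ksign_zero_right, one_smul, nprod_one_D_Tsh_gen, smul_mul_assoc] at this
  exact this

/-- Monomials in the generators are eigenvectors. -/
theorem iSup_eigenspace_eq_top :
    ⨆ μ : ℂ, Module.End.eigenspace (nprod par 1 (D par (Tsh par t))) μ = ⊤ := by
  rw [eq_top_iff]
  rintro v -
  induction v using Fock.ind with
  | one =>
    refine Submodule.mem_iSup_of_mem 0 ?_
    rw [Module.End.mem_eigenspace_iff, nprod_one_right, base_nonneg par (by simp), zero_smul]
  | add u v hu hv => exact Submodule.add_mem _ hu hv
  | smul c u hu => exact Submodule.smul_mem _ _ hu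
  | mul x v hv =>
    induction hv using Submodule.iSup_induction' with
    | mem μ v hv =>
      refine Submodule.mem_iSup_of_mem (μ + wt par t x) ?_
      rw [Module.End.mem_eigenspace_iff] at hv ⊢
      rw [nprod_one_D_Tsh_gen_mul, hv, mul_smul_comm, add_smul]
    | zero => simp
    | add u v _ _ hu hv => rw [mul_add]; exact Submodule.add_mem _ hu hv

/-- The weights of the two generators of a pair add up to a number independent of `t_a`. -/
theorem nprod_one_D_Tsh_evenGen_mul_oddGen (a : A) (k l : ℕ) :
    nprod par 1 (D par (Tsh par t)) (gen par (evenGen par a k) * gen par (oddGen par a l)) =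
      (k + l + 1 : ℂ) • (gen par (evenGen par a k) * gen par (oddGen par a l)) := by
  have h1 : gpar par (evenGen par a k).up a = 0 := by
    simpa only [Gen.parity, evenGen, Nat.cast_zero, add_zero] using evenGen_parity par a 0
  have h2 : gpar par (oddGen par a l).up a = 1 := by
    simpa only [Gen.parity, oddGen, Nat.cast_zero, add_zero, zero_add] using oddGen_parity par a 0
  rw [nprod_one_D_Tsh_gen_mul, nprod_one_D_Tsh_gen, mul_smul_comm, ← add_smul]
  congr 1
  simp only [wt, show (evenGen par a k).idx = a from rfl, show (oddGen par a l).idx = a from rfl,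
    h1, h2]
  simp [evenGen, oddGen]
  ring

theorem nprod_one_D_Tsh_Tsh :
    nprod par 1 (D par (Tsh par t)) (Tsh par t) = (3 : ℂ) • Tsh par t := by
  nth_rw 2 3 [Tsh_eq_sum]
  rw [map_sum, Finset.smul_sum]
  refine Finset.sum_congr rfl fun a _ => ?_
  simp only [superconformalAt, map_add (nprod par 1 _), map_smul (nprod par 1 _),
    nprod_one_D_Tsh_evenGen_mul_oddGen]
  push_cast
  module

theorem nprod_one_D_Tsh_Jsh :
    nprod par 1 (D par (Tsh par t)) (Jsh par t) = (2 : ℂ) • Jsh par t := by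
  rw [Jsh_eq_sum, map_sum, Finset.smul_sum]
  refine Finset.sum_congr rfl fun a _ => ?_
  simp only [currentAt, map_add (nprod par 1 _), map_smul (nprod par 1 _),
    nprod_one_D_Tsh_evenGen_mul_oddGen]
  push_cast
  module

/-! ### Products of the currents -/

theorem nprod_Tsh_Tsh (n : ℕ) : nprod par n (Tsh par t) (Tsh par t) =
    ∑ a, nprod par n (superconformalAt par a (t a)) (superconformalAt par a (t a)) := by
  rw [Tsh_eq_sum]
  exact nprod_sum_sum par n (fun a => superconformalAt_mem_quad par a (t a))
    (fun a => superconformalAt_mem_quad par a (t a))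

theorem nprod_D_Tsh_Tsh (n : ℕ) : nprod par n (D par (Tsh par t)) (Tsh par t) =
    ∑ a, nprod par n (D par (superconformalAt par a (t a))) (superconformalAt par a (t a)) := by
  rw [D_Tsh, Tsh_eq_sum]
  exact nprod_sum_sum par n (fun a => D_mem_quad par (superconformalAt_mem_quad par a (t a)))
    (fun a => superconformalAt_mem_quad par a (t a))

theorem nprod_Tsh_Jsh (n : ℕ) : nprod par n (Tsh par t) (Jsh par t) =
    ∑ a, nprod par n (superconformalAt par a (t a)) (currentAt par a (t a)) := by
  rw [Tsh_eq_sum, Jsh_eq_sum]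
  exact nprod_sum_sum par n (fun a => superconformalAt_mem_quad par a (t a))
    (fun a => currentAt_mem_quad par a (t a))

theorem nprod_D_Tsh_Jsh (n : ℕ) : nprod par n (D par (Tsh par t)) (Jsh par t) =
    ∑ a, nprod par n (D par (superconformalAt par a (t a))) (currentAt par a (t a)) := by
  rw [D_Tsh, Jsh_eq_sum]
  exact nprod_sum_sum par n (fun a => D_mem_quad par (superconformalAt_mem_quad par a (t a)))
    (fun a => currentAt_mem_quad par a (t a))

theorem nprod_Jsh_Jsh (n : ℕ) : nprod par n (Jsh par t) (Jsh par t) =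
    ∑ a, nprod par n (currentAt par a (t a)) (currentAt par a (t a)) := by
  rw [Jsh_eq_sum]
  exact nprod_sum_sum par n (fun a => currentAt_mem_quad par a (t a))
    (fun a => currentAt_mem_quad par a (t a))

theorem nprod_D_Jsh_Jsh (n : ℕ) : nprod par n (D par (Jsh par t)) (Jsh par t) =
    ∑ a, nprod par n (D par (currentAt par a (t a))) (currentAt par a (t a)) := by
  rw [D_Jsh, Jsh_eq_sum]
  exact nprod_sum_sum par n (fun a => D_mem_quad par (currentAt_mem_quad par a (t a)))
    (fun a => currentAt_mem_quad par a (t a))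

theorem bracket_Tsh_Tsh : (fch par).bracket (Tsh par t) (Tsh par t) =
    lamChi 0 0 ((2 : ℂ) • (fch par).del (Tsh par t)) + lamChi 1 0 ((3 : ℂ) • Tsh par t) +
      lamChi 0 1 ((fch par).D (Tsh par t)) + lamChi 2 1 ((csh t / 3) • (fch par).vac) := by
  rw [bracket_eq_iff]
  rintro (_ | _ | _ | j)
  · refine ⟨?_, ?_⟩
    · simp [lamChi, nprod_zero_D_Tsh]; rfl
    · simp [lamChi, nprod_zero_Tsh]; rfl
  · refine ⟨?_, ?_⟩
    · simp [lamChi, nprod_one_D_Tsh_Tsh]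
    · rw [nprod_Tsh_Tsh]
      simp [lamChi, nprod_one_superconformalAt_superconformalAt]
  · refine ⟨?_, ?_⟩
    · rw [nprod_D_Tsh_Tsh]
      simp [lamChi, nprod_two_D_superconformalAt_superconformalAt]
    · rw [nprod_Tsh_Tsh]
      simp [lamChi, nprod_two_superconformalAt_superconformalAt, ← Finset.sum_smul, smul_smul]
      congr 1
      rw [csh, Finset.sum_div, Finset.mul_sum]
      exact Finset.sum_congr rfl fun a _ => by ring
  · rw [nprod_D_Tsh_Tsh, nprod_Tsh_Tsh,
      Finset.sum_eq_zero fun a _ => nprod_quad_quad_of_lt par (by omega)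
        (D_mem_quad par (superconformalAt_mem_quad par a (t a)))
        (superconformalAt_mem_quad par a (t a)),
      Finset.sum_eq_zero fun a _ => nprod_quad_quad_of_lt par (by omega)
        (superconformalAt_mem_quad par a (t a)) (superconformalAt_mem_quad par a (t a))]
    simp [lamChi]

theorem bracket_Tsh_Jsh : (fch par).bracket (Tsh par t) (Jsh par t) =
    lamChi 0 0 ((2 : ℂ) • (fch par).del (Jsh par t)) + lamChi 1 0 ((2 : ℂ) • Jsh par t) +
      lamChi 0 1 ((fch par).D (Jsh par t)) := by
  rw [bracket_eq_iff]
  rintro (_ | _ | _ | j)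
  · refine ⟨?_, ?_⟩
    · simp [lamChi, nprod_zero_D_Tsh]; rfl
    · simp [lamChi, nprod_zero_Tsh]; rfl
  · refine ⟨?_, ?_⟩
    · simp [lamChi, nprod_one_D_Tsh_Jsh]
    · rw [nprod_Tsh_Jsh]
      simp [lamChi, nprod_one_superconformalAt_currentAt]
  · rw [nprod_D_Tsh_Jsh, nprod_Tsh_Jsh,
      Finset.sum_eq_zero (f := fun a => nprod par _ (superconformalAt par a (t a)) _) fun a _ =>
        nprod_quad_quad_of_lt par (by omega)
          (superconformalAt_mem_quad par a (t a)) (currentAt_mem_quad par a (t a))]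
    simp [lamChi, nprod_two_D_superconformalAt_currentAt]
  · rw [nprod_D_Tsh_Jsh, nprod_Tsh_Jsh,
      Finset.sum_eq_zero fun a _ => nprod_quad_quad_of_lt par (by omega)
        (D_mem_quad par (superconformalAt_mem_quad par a (t a))) (currentAt_mem_quad par a (t a)),
      Finset.sum_eq_zero fun a _ => nprod_quad_quad_of_lt par (by omega)
        (superconformalAt_mem_quad par a (t a)) (currentAt_mem_quad par a (t a))]
    simp [lamChi]

theorem bracket_Jsh_Jsh : (fch par).bracket (Jsh par t) (Jsh par t) =
    lamChi 0 0 (Tsh par t) + lamChi 1 1 ((csh t / 3) • (fch par).vac) := by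
  rw [bracket_eq_iff]
  rintro (_ | _ | j)
  · rw [nprod_D_Jsh_Jsh, nprod_Jsh_Jsh, Tsh_eq_sum]
    simp [lamChi, nprod_zero_D_currentAt_currentAt, nprod_zero_currentAt_currentAt]
  · rw [nprod_D_Jsh_Jsh, nprod_Jsh_Jsh]
    refine ⟨by simp [lamChi, nprod_one_D_currentAt_currentAt], ?_⟩
    simp [lamChi, nprod_one_currentAt_currentAt, ← Finset.sum_smul]
    congr 1
    rw [csh, Finset.sum_div]
    exact Finset.sum_congr rfl fun a _ => by ring
  · rw [nprod_D_Jsh_Jsh, nprod_Jsh_Jsh,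
      Finset.sum_eq_zero fun a _ => nprod_quad_quad_of_lt par (by omega)
        (D_mem_quad par (currentAt_mem_quad par a (t a))) (currentAt_mem_quad par a (t a)),
      Finset.sum_eq_zero fun a _ => nprod_quad_quad_of_lt par (by omega)
        (currentAt_mem_quad par a (t a)) (currentAt_mem_quad par a (t a))]
    simp [lamChi]

end Currents

end SusyVA

theorem theorem4p14 {A : Type*} [Fintype A] (par : A → ZMod 2) (t : A → ℂ) :
    (SusyVA.fch par).IsN2Superconformal (SusyVA.Tsh par t) (SusyVA.Jsh par t) (SusyVA.csh t) where
  superconformal :=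
    { odd := SusyVA.Tsh_mem_grade par t
      bracket_self := SusyVA.bracket_Tsh_Tsh par t
      mode_zero_zero := by
        refine LinearMap.ext fun b => ?_
        change SusyVA.smode par 0 0 _ b = _
        rw [SusyVA.smode_zero]
        exact SusyVA.nprod_zero_D_Tsh par t b
      mode_zero_one := by
        refine LinearMap.ext fun b => ?_
        change SusyVA.smode par 0 1 _ b = _
        rw [SusyVA.smode_one]
        exact SusyVA.nprod_zero_Tsh par t b
      diagonalizable := by
        change ⨆ μ : ℂ, Module.End.eigenspace (SusyVA.smode par 1 0 _) μ = ⊤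
        rw [SusyVA.smode_zero]
        exact SusyVA.iSup_eigenspace_eq_top par t }
  even := SusyVA.Jsh_mem_grade par t
  bracket_current := SusyVA.bracket_Tsh_Jsh par t
  bracket_current_current := SusyVA.bracket_Jsh_Jsh par t
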